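/- Correlated Gaussian mixture model. Let $n,d\in\mathbb N$, $\boldsymbol\mu\in\mathbb R^d$ and $\rho\in[0,1]$. Let $\boldsymbol\sigma\in\{-1,+1\}^n$ be a vector of community labels (with an arbitrary law, possibly deterministic), let $\pi_*$ be a uniformly random permutation of $[n]$, and let $\boldsymbol z_1,\dots,\boldsymbol z_n,\boldsymbol w_1,\dots,\boldsymbol w_n$ be i.i.d. $\mathcal N(\mathbf 0,\boldsymbol I_d)$, with $\boldsymbol\sigma$, $\pi_*$, $(\boldsymbol z_i)$, $(\boldsymbol w_i)$ independent. Put $\boldsymbol x_i=\boldsymbol\mu\sigma_i+\boldsymbol z_i$, $\boldsymbol y_i'=\boldsymbol\mu\sigma_i+\rho\boldsymbol z_i+\sqrt{1-\rho^2}\,\boldsymbol w_i$ and $\boldsymbol y_i=\boldsymbol y'_{\pi_*^{-1}(i)}$. Only $X=(\boldsymbol x_1,\dots,\boldsymbol x_n)$ and $Y=(\boldsymbol y_1,\dots,\boldsymbol y_n)$ are observed; we write $(X,Y)\sim\mathrm{CGMMs}(n,\boldsymbol\mu,d,\rho)$. Theorem (impossibility of exact matching). Consider a sequence of such models with $n\to\infty$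 (along any sequence of values of $n$), where $d$, $\boldsymbol\mu$, $\rho$ and the law of $\boldsymbol\sigma$ may vary along the sequence, with no restriction on $\boldsymbol\mu$. Suppose that one of the following holds. (i) For some constant $\epsilon>0$, eventually $\rho<1$ and $$\frac d4\log\frac1{1-\rho^2}\le(1-\epsilon)\log n ,$$ and moreover $d\to\infty$ and $d=O(\log n)$. (ii) For some constant $C>0$, eventually $0<\rho<1$ and $$\frac d4\log\frac1{1-\rho^2}\le\log n-\log d+C\qquad\text{and}\qquad\frac1{\rho^2}-1\le\frac d{40}.$$ Then no estimator achieves exact matching with high probability: for every sequence of (measurable) estimators $\hat\pi=\hat\pi(X,Y)$, which may depend on $n$, $d$, $\boldsymbol\mu$, $\rho$ and the law of $\boldsymbol\sigma$, the probability $\mathbb P\bigl(\hat\pi(X,Y)=\pi_*\bigr)$ does not tend to $1$. -/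

import Mathlib

open MeasureTheory ProbabilityTheory Filter Topology Asymptotics

/-- Permutations of `[n]` form a finite set; every subset is an event. -/
instance permMeasurableSpace (n : ℕ) : MeasurableSpace (Equiv.Perm (Fin n)) := ⊤

namespace CGMM

/-- A database with `n` rows, each row being a vector of `ℝ^d`. -/
abbrev Database (n d : ℕ) : Type := Fin n → EuclideanSpace ℝ (Fin d)

/-- A vector of community labels; `ℤˣ = {1, -1}`. -/
abbrev Labels (n : ℕ) : Type := Fin n → ℤˣ

/-- The latent randomness of the model: labels `σ`, permutation `π`, and noises `z`, `w`. -/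
abbrev Latent (n d : ℕ) : Type :=
  Labels n × Equiv.Perm (Fin n) × Database n d × Database n d

/-- The law of a database whose `n` rows are i.i.d. standard Gaussian `N(0, I_d)`. -/
noncomputable def gaussianDatabase (n d : ℕ) : Measure (Database n d) :=
  Measure.pi fun _ => stdGaussian (EuclideanSpace ℝ (Fin d))

/-- The law of the latent randomness: `σ` has law `ν`, `π` is uniform on `S_n`, the rows of `z`
and `w` are i.i.d. standard Gaussian, and `σ`, `π`, `z`, `w` are independent. -/
noncomputable def latentLaw (n d : ℕ) (ν : PMF (Labels n)) : Measure (Latent n d) :=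
  ν.toMeasure.prod
    ((PMF.uniformOfFintype (Equiv.Perm (Fin n))).toMeasure.prod
      ((gaussianDatabase n d).prod (gaussianDatabase n d)))

/-- The first database, `x_i = μ σ_i + z_i`. -/
noncomputable def databaseX {n d : ℕ} (μ : EuclideanSpace ℝ (Fin d)) :
    Latent n d → Database n d :=
  fun (σ, _, z, _) i => ((σ i : ℤ) : ℝ) • μ + z i

/-- The unpermuted second database, `y'_i = μ σ_i + ρ z_i + √(1 - ρ²) w_i`. -/
noncomputable def databaseY' {n d : ℕ} (μ : EuclideanSpace ℝ (Fin d)) (ρ : ℝ) :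
    Latent n d → Database n d :=
  fun (σ, _, z, w) i => ((σ i : ℤ) : ℝ) • μ + ρ • z i + Real.sqrt (1 - ρ ^ 2) • w i

/-- The observed second database, `y_i = y'_{π⁻¹(i)}`. -/
noncomputable def databaseY {n d : ℕ} (μ : EuclideanSpace ℝ (Fin d)) (ρ : ℝ) :
    Latent n d → Database n d :=
  fun ω i => databaseY' μ ρ ω (ω.2.1.symm i)

/-- The probability that the estimator `est`, applied to `(X, Y) ∼ CGMMs(n, μ, d, ρ)`
(labels of law `ν`), recovers the hidden permutation exactly. -/
noncomputable def exactMatchingProb (n d : ℕ) (μ : EuclideanSpace ℝ (Fin d)) (ρ : ℝ)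
    (ν : PMF (Labels n)) (est : Database n d × Database n d → Equiv.Perm (Fin n)) : ℝ :=
  (latentLaw n d ν).real {ω | est (databaseX μ ω, databaseY μ ρ ω) = ω.2.1}

end CGMM

/-! The error probability is bounded below for each fixed label vector σ, uniformly, and then
averaged over the law of σ. Put κ = ρ/√(1-ρ²). If τ preserves σ, replacing π by πτ and `w i` by `w
(τ i)` + κ(`z (τ i)` - `z i`) leaves X and Y unchanged. By uniformity of π, exchangeability of w and
the Cameron–Martin formula, the new latent law has density exp(`logRatio`) with respect to the old
one (`lintegral_comp_relabel`). Hence, wherever some τ ≠ 1 has nonnegative log-ratio, a correct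
guess is paid for by an equally likely wrong one (`prob_le_two_mul_prob_error`).

For a transposition of two indices with the same label, the log-ratio is -κ⟨Δz, κΔz + Δw⟩. Here μ
has cancelled, which is why μ is unrestricted. It remains to find, with probability bounded below, a
`BadPair` among indices of one label.

This is a second moment argument over pairs in S × T, with S and T disjoint sets of n/4 indices of
one label. Let p be the probability of one bad pair and q that of two bad pairs sharing a row.
Disjoint pairs are independent, so the only dangerous term is of order n³q. The uniform inequality
q² ≤ K p³ (`exists_badProbTwo_sq_le`) makes it O((n²p)^(3/2)), harmless as soon as n²p is bounded
below.

With A = κ² and F = (1+A)^(-d/2) = (1-ρ²)^(d/2), p is at least F up to a factor of order √(1 +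
dA/(1+A)) (`badProb_ge`). A Chernoff bound makes q smaller than F^(3/2) by a factor exponential in
dA/(1+A) (`badProbTwo_le`, `inv_sqrt_pow_four_le`), which absorbs that loss. The threshold
conditions then say exactly what is needed for n²p to stay away from 0. -/

/-! ### Product densities and one-dimensional Gaussian integrals. -/

theorem lintegral_pi_prod_eq {ι : Type*} [Fintype ι] {X : ι → Type*}
    [∀ i, MeasurableSpace (X i)] (m : ∀ i, Measure (X i)) [∀ i, IsProbabilityMeasure (m i)]
    (f : ∀ i, X i → ENNReal) (hf : ∀ i, Measurable (f i)) :
    ∫⁻ x, ∏ i, f i (x i) ∂Measure.pi m = ∏ i, ∫⁻ x, f i x ∂m i := by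
  rw [lintegral_prod_eq_prod_lintegral_of_indepFun Finset.univ (fun i (x : ∀ i, X i) => f i (x i))
    (iIndepFun_pi fun i => (hf i).aemeasurable) (fun i => (hf i).comp (measurable_pi_apply i))]
  refine Finset.prod_congr rfl fun i _ => ?_
  exact (measurePreserving_eval m i).lintegral_comp (hf i)

theorem pi_withDensity_eq {ι : Type*} [Fintype ι] {X : ι → Type*}
    [∀ i, MeasurableSpace (X i)] (m : ∀ i, Measure (X i)) [∀ i, IsProbabilityMeasure (m i)]
    (f : ∀ i, X i → ENNReal) (hf : ∀ i, Measurable (f i))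
    [∀ i, SigmaFinite ((m i).withDensity (f i))] :
    Measure.pi (fun i => (m i).withDensity (f i)) =
      (Measure.pi m).withDensity (fun x => ∏ i, f i (x i)) := by
  refine Measure.pi_eq fun s hs => ?_
  rw [withDensity_apply _ (MeasurableSet.univ_pi hs),
    ← lintegral_indicator (MeasurableSet.univ_pi hs)]
  have : ∀ x, (Set.univ.pi s).indicator (fun x => ∏ i, f i (x i)) x =
      ∏ i, (s i).indicator (f i) (x i) := by
    intro x
    by_cases hx : x ∈ Set.univ.pi s
    · rw [Set.indicator_of_mem hx]
      exact Finset.prod_congr rfl fun i _ => by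
        rw [Set.indicator_of_mem (hx i (Set.mem_univ i))]
    · rw [Set.indicator_of_notMem hx]
      simp only [Set.mem_pi, Set.mem_univ, true_implies, not_forall] at hx
      obtain ⟨i, hi⟩ := hx
      exact (Finset.prod_eq_zero (Finset.mem_univ i) (by simp [hi])).symm
  simp_rw [this]
  rw [lintegral_pi_prod_eq m _ fun i => (hf i).indicator (hs i)]
  refine Finset.prod_congr rfl fun i _ => ?_
  rw [lintegral_indicator (hs i), withDensity_apply _ (hs i)]

/-- Cameron–Martin densities tensorise. It is used twice: from ℝ to ℝ^d, then from one row to n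
rows. -/
theorem pi_map_add_eq_withDensity {ι : Type*} [Fintype ι] {X : Type*} [MeasurableSpace X]
    [AddGroup X] [MeasurableAdd X] (m : ι → Measure X) [∀ i, IsProbabilityMeasure (m i)]
    (h : ι → X) (f : ι → X → ENNReal) (hf : ∀ i, Measurable (f i))
    (hm : ∀ i, (m i).map (fun x => x + h i) = (m i).withDensity (f i)) :
    (Measure.pi m).map (fun x => x + h) =
      (Measure.pi m).withDensity (fun x => ∏ i, f i (x i)) := by
  have : ∀ i, IsProbabilityMeasure ((m i).map fun x => x + h i) := fun i =>
    Measure.isProbabilityMeasure_map (measurable_add_const _).aemeasurable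
  have h2 : ∀ i, SigmaFinite ((m i).withDensity (f i)) := fun i => by
    rw [← hm i]; infer_instance
  rw [← pi_withDensity_eq m f hf]
  simp_rw [← hm]
  exact Measure.pi_map_pi (f := fun i x => x + h i)
    fun i => (measurable_add_const _).aemeasurable

theorem gaussianReal_map_add_eq_withDensity (h : ℝ) :
    (gaussianReal 0 1).map (fun x => x + h) =
      (gaussianReal 0 1).withDensity (fun x => ENNReal.ofReal (Real.exp (h * x - h ^ 2 / 2))) := by
  rw [gaussianReal_map_add_const, gaussianReal_of_var_ne_zero _ one_ne_zero,
    gaussianReal_of_var_ne_zero _ one_ne_zero, ← withDensity_mul _ (by fun_prop) (by fun_prop)]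
  congr 1
  ext x
  simp only [Pi.mul_apply, gaussianPDF]
  rw [← ENNReal.ofReal_mul (gaussianPDFReal_nonneg _ _ _)]
  congr 1
  simp only [gaussianPDFReal_def]
  rw [mul_assoc (√_)⁻¹, ← Real.exp_add]
  congr 2
  simp; ring

theorem lintegral_exp_quadratic_gaussianReal {α : ℝ} (hα : 0 < 1 + 2 * α) (v : ℝ) :
    ∫⁻ x, ENNReal.ofReal (Real.exp (-α * x ^ 2 + v * x)) ∂gaussianReal 0 1 =
      ENNReal.ofReal ((√(1 + 2 * α))⁻¹ * Real.exp (v ^ 2 / (2 * (1 + 2 * α)))) := by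
  set s := 1 + 2 * α with hs
  rw [gaussianReal_of_var_ne_zero _ one_ne_zero,
    lintegral_withDensity_eq_lintegral_mul _ (by fun_prop) (by fun_prop)]
  have hv : s⁻¹.toNNReal ≠ 0 := by simpa using hα
  have key : ∀ x, (gaussianPDF 0 1 * fun x => ENNReal.ofReal (Real.exp (-α * x ^ 2 + v * x))) x =
      ENNReal.ofReal ((√s)⁻¹ * Real.exp (v ^ 2 / (2 * s))) *
        gaussianPDF (v / s) s⁻¹.toNNReal x := by
    intro x
    simp only [Pi.mul_apply, gaussianPDF]
    rw [← ENNReal.ofReal_mul (gaussianPDFReal_nonneg _ _ _), ← ENNReal.ofReal_mul (by positivity)]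
    congr 1
    simp only [gaussianPDFReal_def, Real.coe_toNNReal _ (inv_pos.2 hα).le, NNReal.coe_one,
      mul_one]
    rw [Real.sqrt_mul (x := 2 * Real.pi) (by positivity) s⁻¹, Real.sqrt_inv,
      mul_assoc (√(2 * Real.pi))⁻¹, ← Real.exp_add, mul_inv, inv_inv]
    have hs0 : √s ≠ 0 := by positivity
    have : v ^ 2 / (2 * s) + -(x - v / s) ^ 2 / (2 * s⁻¹) =
        -(x - 0) ^ 2 / 2 + (-α * x ^ 2 + v * x) := by
      have : α = (s - 1) / 2 := by rw [hs]; ring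
      rw [this]
      field_simp
      ring
    rw [← this, Real.exp_add]
    field_simp
  simp_rw [key]
  rw [lintegral_const_mul _ (by fun_prop), lintegral_gaussianPDF_eq_one _ hv, mul_one]

/-! ### Standard Gaussian vectors: exponential moments, shifts, differences. -/

section StdGaussian

variable {d : ℕ}

local notation "𝓔" => EuclideanSpace ℝ (Fin d)

theorem lintegral_stdGaussian (f : 𝓔 → ENNReal) (hf : Measurable f) :
    ∫⁻ x, f x ∂stdGaussian 𝓔 =
      ∫⁻ x, f (WithLp.toLp 2 x) ∂Measure.pi (fun _ : Fin d => gaussianReal 0 1) := by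
  rw [← map_pi_eq_stdGaussian, lintegral_map hf (by fun_prop)]

theorem lintegral_exp_quadratic_stdGaussian {α : ℝ} (hα : 0 < 1 + 2 * α) (v : 𝓔) :
    ∫⁻ x, ENNReal.ofReal (Real.exp (-α * ‖x‖ ^ 2 + inner ℝ x v)) ∂stdGaussian 𝓔 =
      ENNReal.ofReal ((√(1 + 2 * α))⁻¹ ^ d * Real.exp (‖v‖ ^ 2 / (2 * (1 + 2 * α)))) := by
  rw [lintegral_stdGaussian _ (by fun_prop)]
  have : ∀ x : Fin d → ℝ, ENNReal.ofReal (Real.exp (-α * ‖(WithLp.toLp 2 x : 𝓔)‖ ^ 2 +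
      inner ℝ (WithLp.toLp 2 x : 𝓔) v)) =
      ∏ i, ENNReal.ofReal (Real.exp (-α * x i ^ 2 + v i * x i)) := by
    intro x
    rw [← ENNReal.ofReal_prod_of_nonneg (fun i _ => by positivity), ← Real.exp_sum,
      Finset.sum_add_distrib, EuclideanSpace.real_norm_sq_eq, Finset.mul_sum]
    simp [PiLp.inner_apply]
  simp_rw [this]
  rw [lintegral_pi_prod_eq (fun _ : Fin d => gaussianReal 0 1)
    (fun i x => ENNReal.ofReal (Real.exp (-α * x ^ 2 + v i * x))) (by fun_prop)]
  simp_rw [lintegral_exp_quadratic_gaussianReal hα]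
  rw [← ENNReal.ofReal_prod_of_nonneg (fun i _ => by positivity), Finset.prod_mul_distrib,
    ← Real.exp_sum, EuclideanSpace.real_norm_sq_eq, Finset.sum_div]
  simp

theorem stdGaussian_map_add_eq_withDensity (h : 𝓔) :
    (stdGaussian 𝓔).map (fun x => x + h) = (stdGaussian 𝓔).withDensity
      (fun x => ENNReal.ofReal (Real.exp (inner ℝ h x - ‖h‖ ^ 2 / 2))) := by
  have h1 := pi_map_add_eq_withDensity (fun _ : Fin d => gaussianReal 0 1) (fun i => h i)
    (fun i x => ENNReal.ofReal (Real.exp (h i * x - h i ^ 2 / 2))) (by fun_prop)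
    (fun i => gaussianReal_map_add_eq_withDensity (h i))
  refine Measure.ext_of_lintegral _ fun f hf => ?_
  rw [lintegral_map hf (by fun_prop), lintegral_stdGaussian _ (by fun_prop),
    lintegral_withDensity_eq_lintegral_mul _ (by fun_prop) hf,
    lintegral_stdGaussian _ (by fun_prop)]
  have h2 := congrArg (fun m => ∫⁻ x, f (WithLp.toLp 2 x) ∂m) h1
  simp only at h2
  rw [lintegral_map (by fun_prop) (by fun_prop), lintegral_withDensity_eq_lintegral_mul _
    (by fun_prop) (by fun_prop)] at h2
  refine Eq.trans ?_ (h2.trans ?_)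
  · rfl
  · refine lintegral_congr fun x => ?_
    simp only [Pi.mul_apply]
    congr 1
    rw [← ENNReal.ofReal_prod_of_nonneg (fun i _ => by positivity), ← Real.exp_sum,
      Finset.sum_sub_distrib, EuclideanSpace.real_norm_sq_eq, Finset.sum_div]
    simp [PiLp.inner_apply, mul_comm]

theorem gaussianDatabase_map_add_eq_withDensity {n : ℕ} (h : CGMM.Database n d) :
    (CGMM.gaussianDatabase n d).map (fun x => x + h) = (CGMM.gaussianDatabase n d).withDensity
      (fun x => ENNReal.ofReal (Real.exp (∑ i, (inner ℝ (h i) (x i) - ‖h i‖ ^ 2 / 2)))) := by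
  have := pi_map_add_eq_withDensity (fun _ : Fin n => stdGaussian 𝓔) h
    (fun i x => ENNReal.ofReal (Real.exp (inner ℝ (h i) x - ‖h i‖ ^ 2 / 2))) (by fun_prop)
    (fun i => stdGaussian_map_add_eq_withDensity (h i))
  rw [CGMM.gaussianDatabase, this]
  congr 1
  ext x
  rw [← ENNReal.ofReal_prod_of_nonneg (fun i _ => by positivity), ← Real.exp_sum]

theorem stdGaussian_prod_map_sub :
    ((stdGaussian 𝓔).prod (stdGaussian 𝓔)).map (fun x => x.1 - x.2) =
      (stdGaussian 𝓔).map (fun x => √2 • x) := by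
  have hn : (stdGaussian 𝓔).map (fun x => -x) = stdGaussian 𝓔 :=
    stdGaussian_map (LinearIsometryEquiv.neg ℝ (E := 𝓔))
  have hc : ((stdGaussian 𝓔).prod (stdGaussian 𝓔)).map (fun x => x.1 - x.2) =
      (stdGaussian 𝓔) ∗ (stdGaussian 𝓔) := by
    have h2 := Measure.map_prod_map (stdGaussian 𝓔) (stdGaussian 𝓔) measurable_id
      (measurable_neg (G := 𝓔))
    rw [Measure.map_id, show Neg.neg = fun x : 𝓔 => -x from rfl, hn] at h2
    rw [Measure.conv, h2, Measure.map_map (by fun_prop) (by fun_prop)]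
    congr 1
    ext x
    simp [sub_eq_add_neg]
  rw [hc]
  have : IsProbabilityMeasure ((stdGaussian 𝓔).map fun x => √2 • x) :=
    Measure.isProbabilityMeasure_map (by fun_prop)
  refine Measure.ext_of_charFun ?_
  ext t
  rw [charFun_conv, charFun_map_smul, charFun_stdGaussian, charFun_stdGaussian, ← Complex.exp_add]
  congr 1
  rw [norm_smul]
  push_cast
  rw [mul_pow, ← Complex.ofReal_pow ‖√2‖]
  simp
  ring

theorem stdGaussian_map_inner (a : 𝓔) :
    (stdGaussian 𝓔).map (fun x => inner ℝ a x) = gaussianReal 0 (‖a‖ ^ 2).toNNReal := by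
  have := IsGaussian.map_eq_gaussianReal (μ := stdGaussian 𝓔) (innerSL ℝ a)
  rw [integral_strongDual_stdGaussian, variance_dual_stdGaussian, innerSL_apply_norm] at this
  exact this

end StdGaussian

/-- The tail of a centered Gaussian variable of standard deviation `s`. -/
theorem gaussianReal_Iic_ge {s x : ℝ} (hs : 0 < s) (hx : 0 ≤ x) :
    ENNReal.ofReal (Real.exp (-3) * (Real.exp (-x ^ 2 / 2) / (1 + x))) ≤
      gaussianReal 0 (s ^ 2).toNNReal (Set.Iic (-(x * s))) := by
  have hv : (s ^ 2).toNNReal ≠ 0 := by simpa using hs.ne'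
  -- Only the slice of the tail of width δs is kept: there (x+δ)² ≤ x² + 3, so the density loses at
  -- most a factor exp(-3/2).
  set δ := 1 / (1 + x) with hδ
  have hδ0 : 0 < δ := by positivity
  calc _ ≤ ENNReal.ofReal ((√(2 * Real.pi * s ^ 2))⁻¹ * Real.exp (-(x + δ) ^ 2 / 2)) *
        volume (Set.Icc (-((x + δ) * s)) (-(x * s))) := by
        rw [Real.volume_Icc, ← ENNReal.ofReal_mul (by positivity)]
        apply ENNReal.ofReal_le_ofReal
        rw [Real.sqrt_mul (by positivity), Real.sqrt_sq hs.le]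
        have h1 : √(2 * Real.pi) ≤ 3 := by
          rw [Real.sqrt_le_left (by norm_num)]
          nlinarith [Real.pi_lt_d2]
        have h2 : Real.exp (-3) ≤ 1 / 3 * Real.exp (-3 / 2) := by
          have : (3 : ℝ) ≤ Real.exp (3 / 2) := by
            have := Real.add_one_le_exp (1 / 2 : ℝ)
            have h3 : Real.exp (3 / 2 : ℝ) = Real.exp (1 / 2) ^ 3 := by
              rw [← Real.exp_nat_mul]; norm_num
            rw [h3]
            calc (3 : ℝ) ≤ (1 / 2 + 1) ^ 3 := by norm_num
              _ ≤ _ := by gcongr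
          have h4 : Real.exp (-3) = Real.exp (-3 / 2) * (Real.exp (3 / 2))⁻¹ := by
            rw [← Real.exp_neg, ← Real.exp_add]; norm_num
          rw [h4, mul_comm]
          gcongr
          rw [inv_le_comm₀ (by positivity) (by norm_num)]
          simpa using this
        have h3 : Real.exp (-3 / 2) * Real.exp (-x ^ 2 / 2) ≤ Real.exp (-(x + δ) ^ 2 / 2) := by
          rw [← Real.exp_add]
          apply Real.exp_le_exp.2
          have e1 : x * δ ≤ 1 := by
            rw [hδ, mul_one_div, div_le_one (by positivity)]; linarith
          have e2 : δ ≤ 1 := by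
            rw [hδ, div_le_one (by positivity)]; linarith
          nlinarith
        have h5 : (√(2 * Real.pi) * s)⁻¹ * Real.exp (-(x + δ) ^ 2 / 2) *
            (-(x * s) - -((x + δ) * s)) =
            (√(2 * Real.pi))⁻¹ * Real.exp (-(x + δ) ^ 2 / 2) * δ := by
          field_simp
          ring
        rw [h5]
        calc Real.exp (-3) * (Real.exp (-x ^ 2 / 2) / (1 + x))
            ≤ 1 / 3 * Real.exp (-3 / 2) * (Real.exp (-x ^ 2 / 2) / (1 + x)) := by gcongr
          _ = 3⁻¹ * (Real.exp (-3 / 2) * Real.exp (-x ^ 2 / 2)) * δ := by rw [hδ]; ring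
          _ ≤ _ := by gcongr
    _ = ∫⁻ y in Set.Icc (-((x + δ) * s)) (-(x * s)),
          ENNReal.ofReal ((√(2 * Real.pi * s ^ 2))⁻¹ * Real.exp (-(x + δ) ^ 2 / 2)) := by
        rw [setLIntegral_const]
    _ ≤ ∫⁻ y in Set.Icc (-((x + δ) * s)) (-(x * s)),
          gaussianPDF 0 (s ^ 2).toNNReal y := by
        refine setLIntegral_mono (by fun_prop) fun y hy => ?_
        simp only [gaussianPDF, gaussianPDFReal_def]
        apply ENNReal.ofReal_le_ofReal
        rw [Real.coe_toNNReal _ (sq_nonneg s)]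
        gcongr ?_ * Real.exp ?_
        rw [div_le_div_iff₀ (by norm_num) (by positivity)]
        have h1 : (y - 0) ^ 2 ≤ ((x + δ) * s) ^ 2 := by
          apply sq_le_sq'
          · linarith [hy.1]
          · have : 0 ≤ x * s := by positivity
            have : 0 ≤ (x + δ) * s := by positivity
            linarith [hy.2]
        nlinarith
    _ ≤ ∫⁻ y in Set.Iic (-(x * s)), gaussianPDF 0 (s ^ 2).toNNReal y :=
        lintegral_mono_set Set.Icc_subset_Iic_self
    _ = _ := (gaussianReal_apply _ hv _).symm

/-! ### Probabilities of one bad pair and of two bad pairs sharing a row. -/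

section PairProbability

variable {d : ℕ}

local notation "𝓔" => EuclideanSpace ℝ (Fin d)

/-- For rows `(z, w)`, `(z', w')` of the noise, exchanging the two rows of the second database does
not decrease the likelihood; here `κ = ρ / √(1 - ρ²)`. -/
def BadPair (κ : ℝ) (ξ ξ' : 𝓔 × 𝓔) : Prop :=
  inner ℝ (ξ.1 - ξ'.1) (κ • (ξ.1 - ξ'.1) + (ξ.2 - ξ'.2)) ≤ 0

theorem BadPair.symm {κ : ℝ} {ξ ξ' : 𝓔 × 𝓔} (h : BadPair κ ξ ξ') : BadPair κ ξ' ξ := by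
  unfold BadPair at *
  have : inner ℝ (ξ'.1 - ξ.1) (κ • (ξ'.1 - ξ.1) + (ξ'.2 - ξ.2)) =
      inner ℝ (ξ.1 - ξ'.1) (κ • (ξ.1 - ξ'.1) + (ξ.2 - ξ'.2)) := by
    rw [← neg_sub ξ.1, ← neg_sub ξ.2, smul_neg, ← neg_add, inner_neg_neg]
  rwa [this]

theorem measurableSet_badPair {α : Type*} [MeasurableSpace α] (κ : ℝ) {f g : α → 𝓔 × 𝓔}
    (hf : Measurable f) (hg : Measurable g) : MeasurableSet {x | BadPair κ (f x) (g x)} := by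
  unfold BadPair
  exact measurableSet_le (by fun_prop) measurable_const

variable (d) in
/-- The law of a pair of independent standard Gaussian vectors. -/
noncomputable def rowLaw : Measure (𝓔 × 𝓔) := (stdGaussian 𝓔).prod (stdGaussian 𝓔)

instance : IsProbabilityMeasure (rowLaw d) := by unfold rowLaw; infer_instance

variable (d) in
/-- The probability that a given pair of rows is bad. -/
noncomputable def badProb (κ : ℝ) : ℝ :=
  ((rowLaw d).prod (rowLaw d)).real {x | BadPair κ x.1 x.2}

variable (d) in
/-- The probability that a given row forms a bad pair with each of two other rows. -/
noncomputable def badProbTwo (κ : ℝ) : ℝ :=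
  ((rowLaw d).prod ((rowLaw d).prod (rowLaw d))).real
    {x | BadPair κ x.1 x.2.1 ∧ BadPair κ x.1 x.2.2}

/-- The differences of the z-parts and of the w-parts are independent, each distributed as √2 times
a standard Gaussian vector. -/
theorem lintegral_rowLaw_sub (F : 𝓔 → 𝓔 → ENNReal) (hF : Measurable (Function.uncurry F)) :
    ∫⁻ x, F (x.1.1 - x.2.1) (x.1.2 - x.2.2) ∂(rowLaw d).prod (rowLaw d) =
      ∫⁻ g, ∫⁻ h, F (√2 • g) (√2 • h) ∂stdGaussian 𝓔 ∂stdGaussian 𝓔 := by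
  have hF1 : ∀ {α : Type} [MeasurableSpace α] {f g : α → 𝓔}, Measurable f → Measurable g →
      Measurable fun x => F (f x) (g x) := fun hf hg => hF.comp (hf.prodMk hg)
  have hsub : ∀ f : 𝓔 → ENNReal, Measurable f →
      ∫⁻ z, ∫⁻ z', f (z - z') ∂stdGaussian 𝓔 ∂stdGaussian 𝓔 =
        ∫⁻ g, f (√2 • g) ∂stdGaussian 𝓔 := by
    intro f hf
    have h1 : Measurable fun x : 𝓔 × 𝓔 => f (x.1 - x.2) := hf.comp (by fun_prop)
    rw [← lintegral_prod (fun x : 𝓔 × 𝓔 => f (x.1 - x.2)) h1.aemeasurable,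
      ← lintegral_map hf (by fun_prop), stdGaussian_prod_map_sub, lintegral_map hf (by fun_prop)]
  rw [lintegral_prod _ (hF1 (by fun_prop) (by fun_prop)).aemeasurable]
  unfold rowLaw
  rw [lintegral_prod _ (Measurable.lintegral_prod_right'
    (f := fun x : (𝓔 × 𝓔) × 𝓔 × 𝓔 => F (x.1.1 - x.2.1) (x.1.2 - x.2.2))
    (hF1 (by fun_prop) (by fun_prop))).aemeasurable]
  have h1 : ∀ z w : 𝓔, ∫⁻ y : 𝓔 × 𝓔, F (z - y.1) (w - y.2)
      ∂(stdGaussian 𝓔).prod (stdGaussian 𝓔) =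
      ∫⁻ z', ∫⁻ w', F (z - z') (w - w') ∂stdGaussian 𝓔 ∂stdGaussian 𝓔 := fun z w =>
    lintegral_prod _ (hF1 (by fun_prop) (by fun_prop)).aemeasurable
  simp_rw [h1]
  have h2 : ∀ z : 𝓔, ∫⁻ w, ∫⁻ z', ∫⁻ w', F (z - z') (w - w')
      ∂stdGaussian 𝓔 ∂stdGaussian 𝓔 ∂stdGaussian 𝓔 =
      ∫⁻ z', ∫⁻ h, F (z - z') (√2 • h) ∂stdGaussian 𝓔 ∂stdGaussian 𝓔 := by
    intro z
    rw [lintegral_lintegral_swap]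
    · refine lintegral_congr fun z' => ?_
      exact hsub (F (z - z')) (hF1 (by fun_prop) (by fun_prop))
    · exact (Measurable.lintegral_prod_right' (f := fun x : (𝓔 × 𝓔) × 𝓔 =>
        F (z - x.1.2) (x.1.1 - x.2)) (hF1 (by fun_prop) (by fun_prop))).aemeasurable
  simp_rw [h2]
  exact hsub (fun a => ∫⁻ h, F a (√2 • h) ∂stdGaussian 𝓔)
    (Measurable.lintegral_prod_right' (f := fun x : 𝓔 × 𝓔 => F x.1 (√2 • x.2))
      (hF1 (by fun_prop) (by fun_prop)))

theorem stdGaussian_halfspace_ge {κ : ℝ} (hκ : 0 ≤ κ) (g : 𝓔) :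
    ENNReal.ofReal (Real.exp (-3) * (Real.exp (-(κ * ‖g‖) ^ 2 / 2) / (1 + κ * ‖g‖))) ≤
      stdGaussian 𝓔 {h | inner ℝ g h ≤ -(κ * ‖g‖ * ‖g‖)} := by
  by_cases hg : g = 0
  · subst hg
    simp
  · have h1 : {h : 𝓔 | inner ℝ g h ≤ -(κ * ‖g‖ * ‖g‖)} =
        (fun h => inner ℝ g h) ⁻¹' Set.Iic (-(κ * ‖g‖ * ‖g‖)) := rfl
    rw [h1, ← Measure.map_apply (by fun_prop) measurableSet_Iic, stdGaussian_map_inner]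
    exact gaussianReal_Iic_ge (norm_pos_iff.2 hg) (by positivity)

/-- The common factor √2 does not affect the sign, so the event is ⟨g, κg + h⟩ ≤ 0; given g, it is a
half-space for h at distance κ‖g‖ from the origin. -/
theorem badProb_ge_lintegral {κ : ℝ} (hκ : 0 ≤ κ) :
    ∫⁻ g, ENNReal.ofReal (Real.exp (-3) * (Real.exp (-(κ * ‖g‖) ^ 2 / 2) / (1 + κ * ‖g‖)))
      ∂stdGaussian 𝓔 ≤ ENNReal.ofReal (badProb d κ) := by
  rw [badProb, ofReal_measureReal]
  have h0 : MeasurableSet {x : 𝓔 × 𝓔 | inner ℝ x.1 (κ • x.1 + x.2) ≤ 0} :=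
    measurableSet_le (by fun_prop) measurable_const
  have h1 := lintegral_rowLaw_sub (d := d)
    (fun a b => {x : 𝓔 × 𝓔 | inner ℝ x.1 (κ • x.1 + x.2) ≤ 0}.indicator 1 (a, b))
    (measurable_one.indicator h0)
  have h2 : ((rowLaw d).prod (rowLaw d)) {x | BadPair κ x.1 x.2} =
      ∫⁻ x, {x : 𝓔 × 𝓔 | inner ℝ x.1 (κ • x.1 + x.2) ≤ 0}.indicator 1
        (x.1.1 - x.2.1, x.1.2 - x.2.2) ∂(rowLaw d).prod (rowLaw d) := by
    rw [← lintegral_indicator_one (measurableSet_badPair κ measurable_fst measurable_snd)]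
    rfl
  rw [h2, h1]
  refine lintegral_mono fun g => ?_
  refine (stdGaussian_halfspace_ge hκ g).trans ?_
  rw [← lintegral_indicator_one (measurableSet_le (by fun_prop) measurable_const)]
  refine lintegral_mono fun h => ?_
  refine Set.indicator_le_indicator_apply_of_subset ?_ (by simp) |>.trans
    (le_of_eq (b := Set.indicator ((fun h => (√2 • g, √2 • h)) ⁻¹'
      {x : 𝓔 × 𝓔 | inner ℝ x.1 (κ • x.1 + x.2) ≤ 0}) 1 h) rfl)
  intro h hh
  simp only [Set.mem_ofPred_eq, Set.mem_preimage, inner_add_right, inner_smul_left,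
    inner_smul_right, real_inner_self_eq_norm_sq, norm_smul, mul_pow, Real.norm_eq_abs, sq_abs] at hh ⊢
  have e : √2 * √2 = (2 : ℝ) := Real.mul_self_sqrt (by norm_num)
  simp only [conj_trivial, sq √2, e, ← mul_assoc]
  nlinarith

/-- One coordinate at a time this is 1 + A ≤ (1 + A/2)(1 + x) ≤ (1 + A/2)eˣ with x = A/(1+A). -/
theorem inv_sqrt_pow_le_exp {A : ℝ} (hA : 0 ≤ A) :
    (√(1 + A / 2))⁻¹ ^ d ≤ (√(1 + A))⁻¹ ^ d * Real.exp (d * A / (1 + A) / 2) := by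
  have h1 : √(1 + A) ≤ √(1 + A / 2) * Real.exp (A / (1 + A) / 2) := by
    rw [← Real.sqrt_sq (Real.exp_pos (A / (1 + A) / 2)).le, ← Real.sqrt_mul (by positivity)]
    apply Real.sqrt_le_sqrt
    rw [← Real.exp_nat_mul]
    have h2 := Real.add_one_le_exp (A / (1 + A))
    have h3 : ((2 : ℕ) : ℝ) * (A / (1 + A) / 2) = A / (1 + A) := by push_cast; ring
    rw [h3]
    calc 1 + A ≤ (1 + A / 2) * (A / (1 + A) + 1) := by
          rw [div_add_one (by positivity), mul_div_assoc', le_div_iff₀ (by positivity)]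
          nlinarith
      _ ≤ _ := by gcongr
  have h4 : Real.exp (d * A / (1 + A) / 2) = Real.exp (A / (1 + A) / 2) ^ d := by
    rw [← Real.exp_nat_mul]; congr 1; ring
  rw [h4, ← mul_pow]
  gcongr
  rw [inv_le_iff_one_le_mul₀ (by positivity), mul_assoc, inv_mul_eq_div,
    le_div_iff₀ (by positivity), one_mul, mul_comm]
  exact h1

/-- Without the denominator 1 + κ‖g‖, the Gaussian tail would integrate to (1+A)^(-d/2). Under the
tilted measure κ²‖g‖² has mean dA/(1+A), so the denominator costs only the square root of that
order. -/
theorem badProb_ge {κ : ℝ} (hκ : 0 ≤ κ) :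
    Real.exp (-3) / 2 * ((√(1 + κ ^ 2))⁻¹ ^ d /
      (1 + √(2 * (d * κ ^ 2 / (1 + κ ^ 2)) + 4))) ≤ badProb d κ := by
  set A := κ ^ 2 with hA
  have hA0 : 0 ≤ A := sq_nonneg κ
  -- Truncation level for κ²‖g‖²: above it half of the exponent is traded for exp(-t/4), and t/4 =
  -- dA/(2(1+A)) + 1 makes the discarded part at most F/e ≤ F/2.
  set t := 2 * (d * A / (1 + A)) + 4 with ht
  have ht0 : 0 ≤ t := by positivity
  set F := (√(1 + A))⁻¹ ^ d with hF
  have hp : 0 ≤ badProb d κ := measureReal_nonneg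
  have pt : ∀ g : 𝓔, ENNReal.ofReal (Real.exp (-(A / 2) * ‖g‖ ^ 2 + inner ℝ g 0)) ≤
      ENNReal.ofReal ((1 + √t) * Real.exp 3) * ENNReal.ofReal (Real.exp (-3) *
        (Real.exp (-(κ * ‖g‖) ^ 2 / 2) / (1 + κ * ‖g‖))) + ENNReal.ofReal (Real.exp (-t / 4)) *
        ENNReal.ofReal (Real.exp (-(A / 4) * ‖g‖ ^ 2 + inner ℝ g 0)) := by
    intro g
    rw [← ENNReal.ofReal_mul (by positivity), ← ENNReal.ofReal_mul (by positivity),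
      ← ENNReal.ofReal_add (by positivity) (by positivity), inner_zero_right]
    apply ENNReal.ofReal_le_ofReal
    have e1 : -(κ * ‖g‖) ^ 2 / 2 = -(A / 2) * ‖g‖ ^ 2 + 0 := by rw [hA]; ring
    have e2 : (1 + √t) * Real.exp 3 * (Real.exp (-3) *
        (Real.exp (-(κ * ‖g‖) ^ 2 / 2) / (1 + κ * ‖g‖))) =
        Real.exp (-(A / 2) * ‖g‖ ^ 2 + 0) * ((1 + √t) / (1 + κ * ‖g‖)) := by
      rw [e1, Real.exp_neg]
      field_simp
    rw [e2]
    by_cases hy : κ * ‖g‖ ≤ √t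
    · have : 1 ≤ (1 + √t) / (1 + κ * ‖g‖) := by
        rw [one_le_div (by positivity)]; linarith
      have h3 := Real.exp_pos (-(A / 2) * ‖g‖ ^ 2 + 0)
      have : 0 < Real.exp (-t / 4) * Real.exp (-(A / 4) * ‖g‖ ^ 2 + 0) := by positivity
      nlinarith
    · have h3 : t ≤ A * ‖g‖ ^ 2 := by
        rw [hA, ← mul_pow]
        exact (Real.sqrt_le_left (by positivity)).1 (not_le.1 hy).le
      have h4 : Real.exp (-(A / 2) * ‖g‖ ^ 2 + 0) ≤
          Real.exp (-t / 4) * Real.exp (-(A / 4) * ‖g‖ ^ 2 + 0) := by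
        rw [← Real.exp_add]
        apply Real.exp_le_exp.2
        linarith
      have : 0 ≤ Real.exp (-(A / 2) * ‖g‖ ^ 2 + 0) * ((1 + √t) / (1 + κ * ‖g‖)) := by positivity
      linarith
  have h := lintegral_mono (μ := stdGaussian 𝓔) pt
  rw [lintegral_add_left (by fun_prop), lintegral_const_mul _ (by fun_prop),
    lintegral_const_mul _ (by fun_prop), lintegral_exp_quadratic_stdGaussian (by linarith),
    lintegral_exp_quadratic_stdGaussian (by linarith)] at h
  have h5 := h.trans (add_le_add_left (mul_le_mul_right (badProb_ge_lintegral hκ) _) _)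
  rw [← ENNReal.ofReal_mul (by positivity), ← ENNReal.ofReal_mul (by positivity),
    ← ENNReal.ofReal_add (by positivity) (by positivity),
    ENNReal.ofReal_le_ofReal_iff (by positivity)] at h5
  simp only [norm_zero, ne_eq, OfNat.ofNat_ne_zero, not_false_eq_true, zero_pow, zero_div,
    Real.exp_zero, mul_one] at h5
  rw [show 1 + 2 * (A / 2) = 1 + A by ring, show 1 + 2 * (A / 4) = 1 + A / 2 by ring] at h5
  have h6 := inv_sqrt_pow_le_exp (d := d) hA0
  have h7 : Real.exp (-t / 4) * (√(1 + A / 2))⁻¹ ^ d ≤ F / 2 := by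
    calc _ ≤ Real.exp (-t / 4) * (F * Real.exp (d * A / (1 + A) / 2)) := by gcongr
      _ = F * Real.exp (-1) := by
        rw [mul_left_comm, ← Real.exp_add]; congr 2; rw [ht]; ring
      _ ≤ F * (1 / 2) := by
        gcongr
        rw [Real.exp_neg, one_div]
        gcongr
        have := Real.add_one_le_exp (1 : ℝ)
        linarith
      _ = _ := by ring
  have h8 : F / 2 ≤ (1 + √t) * Real.exp 3 * badProb d κ := by
    have : (√(1 + A))⁻¹ ^ d = F := rfl
    linarith
  rw [Real.exp_neg, div_mul_div_comm, div_le_iff₀ (by positivity), inv_mul_le_iff₀ (by positivity)]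
  linarith

theorem lintegral_exp_quadratic_stdGaussian_of_eq {α : ℝ} (hα : 0 < 1 + 2 * α) {f : 𝓔 → ℝ} (v : 𝓔)
    (c : ℝ) (hf : ∀ x, f x = -α * ‖x‖ ^ 2 + inner ℝ x v + c) :
    ∫⁻ x, ENNReal.ofReal (Real.exp (f x)) ∂stdGaussian 𝓔 =
      ENNReal.ofReal ((√(1 + 2 * α))⁻¹ ^ d *
        Real.exp (‖v‖ ^ 2 / (2 * (1 + 2 * α)) + c)) := by
  simp_rw [hf, Real.exp_add _ c, ENNReal.ofReal_mul (Real.exp_pos _).le]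
  rw [lintegral_mul_const _ (by fun_prop), lintegral_exp_quadratic_stdGaussian hα,
    ← ENNReal.ofReal_mul (by positivity), mul_assoc]

/-- Chernoff bound with the first row frozen. The tilt 2κ/5 is chosen for two pairs sharing a row:
to first order in κ², the tilt λκ gives the rate (4λ - 5λ²)κ²d, largest at λ = 2/5. The tilt κ/2,
optimal for one pair, would only reach the rate of F^(3/2), with no exponential gain. -/
theorem rowLaw_badPair_le {κ : ℝ} (hκ : 0 ≤ κ) (z w : 𝓔) :
    rowLaw d {ξ | BadPair κ (z, w) ξ} ≤ ENNReal.ofReal ((√(1 + 16 / 25 * κ ^ 2))⁻¹ ^ d *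
      Real.exp ((-(8 / 25) * κ ^ 2 * ‖z‖ ^ 2 - 2 / 5 * κ * inner ℝ z w + 2 / 25 * κ ^ 2 * ‖w‖ ^ 2) /
        (1 + 16 / 25 * κ ^ 2))) := by
  have h1 : rowLaw d {ξ | BadPair κ (z, w) ξ} ≤ ∫⁻ ξ, ENNReal.ofReal (Real.exp (-(2 / 5 * κ) *
      inner ℝ (z - ξ.1) (κ • (z - ξ.1) + (w - ξ.2)))) ∂rowLaw d := by
    rw [← lintegral_indicator_one (measurableSet_badPair κ measurable_const measurable_id')]
    refine lintegral_mono fun ξ => ?_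
    by_cases hξ : BadPair κ (z, w) ξ
    · rw [Set.indicator_of_mem (by exact hξ)]
      simp only [Pi.one_apply, ENNReal.one_le_ofReal, Real.one_le_exp_iff]
      exact mul_nonneg_of_nonpos_of_nonpos (by linarith) hξ
    · rw [Set.indicator_of_notMem (by exact hξ)]
      exact zero_le
  refine h1.trans (le_of_eq ?_)
  rw [rowLaw, lintegral_prod _ (by fun_prop)]
  have h2 : ∀ z' : 𝓔, ∫⁻ w', ENNReal.ofReal (Real.exp (-(2 / 5 * κ) *
      inner ℝ (z - z') (κ • (z - z') + (w - w')))) ∂stdGaussian 𝓔 =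
      ENNReal.ofReal (Real.exp (-(8 / 25) * κ ^ 2 * ‖z - z'‖ ^ 2 -
        2 / 5 * κ * inner ℝ (z - z') w)) := by
    intro z'
    rw [lintegral_exp_quadratic_stdGaussian_of_eq (α := 0) (by norm_num) ((2 / 5 * κ) • (z - z'))
      (-(2 / 5) * κ ^ 2 * ‖z - z'‖ ^ 2 - 2 / 5 * κ * inner ℝ (z - z') w)]
    · congr 1
      simp [norm_smul, mul_pow]
      ring
    · intro w'
      rw [inner_add_right, inner_smul_right, real_inner_self_eq_norm_sq, inner_sub_right,
        inner_smul_right, real_inner_comm w' (z - z')]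
      ring
  simp_rw [h2]
  set D := 1 + 16 / 25 * κ ^ 2 with hD
  have hD0 : D ≠ 0 := by positivity
  rw [lintegral_exp_quadratic_stdGaussian_of_eq (α := 8 / 25 * κ ^ 2) (by positivity)
    ((16 / 25 * κ ^ 2) • z + (2 / 5 * κ) • w)
    (-(8 / 25) * κ ^ 2 * ‖z‖ ^ 2 - 2 / 5 * κ * inner ℝ z w)]
  · rw [show 1 + 2 * (8 / 25 * κ ^ 2) = D by rw [hD]; ring]
    congr 3
    rw [norm_add_sq_real, norm_smul, norm_smul, mul_pow, mul_pow, inner_smul_left, inner_smul_right]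
    simp only [Real.norm_eq_abs, sq_abs, conj_trivial]
    field_simp
    rw [hD]
    ring
  · intro z'
    rw [norm_sub_sq_real, inner_sub_left, inner_add_right, inner_smul_right, inner_smul_right,
      real_inner_comm z z']
    ring

/-- Given the shared row, the two events are independent with the same probability, so the
conditional Chernoff bound is squared and integrated over that row. -/
theorem badProbTwo_le {κ : ℝ} (hκ : 0 ≤ κ) :
    badProbTwo d κ ≤ (√(1 + 16 / 25 * κ ^ 2))⁻¹ ^ d * (√(1 + 24 / 25 * κ ^ 2))⁻¹ ^ d := by
  rw [badProbTwo, measureReal_def]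
  refine ENNReal.toReal_le_of_le_ofReal (by positivity) ?_
  have hms : MeasurableSet {x : (𝓔 × 𝓔) × (𝓔 × 𝓔) × (𝓔 × 𝓔) |
      BadPair κ x.1 x.2.1 ∧ BadPair κ x.1 x.2.2} :=
    (measurableSet_badPair κ (by fun_prop) (by fun_prop)).inter
      (measurableSet_badPair κ (by fun_prop) (by fun_prop))
  rw [Measure.prod_apply hms]
  set D := 1 + 16 / 25 * κ ^ 2 with hD
  have hD0 : 0 < D := by positivity
  have h1 : ∀ ξ : 𝓔 × 𝓔, ((rowLaw d).prod (rowLaw d)) (Prod.mk ξ ⁻¹'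
      {x : (𝓔 × 𝓔) × (𝓔 × 𝓔) × (𝓔 × 𝓔) | BadPair κ x.1 x.2.1 ∧ BadPair κ x.1 x.2.2}) ≤
      ENNReal.ofReal (D⁻¹ ^ d) * ENNReal.ofReal (Real.exp ((-(16 / 25) * κ ^ 2 * ‖ξ.1‖ ^ 2 -
        4 / 5 * κ * inner ℝ ξ.1 ξ.2 + 4 / 25 * κ ^ 2 * ‖ξ.2‖ ^ 2) / D)) := by
    intro ξ
    have : (Prod.mk ξ ⁻¹' {x : (𝓔 × 𝓔) × (𝓔 × 𝓔) × (𝓔 × 𝓔) |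
        BadPair κ x.1 x.2.1 ∧ BadPair κ x.1 x.2.2}) =
        {ξ' | BadPair κ ξ ξ'} ×ˢ {ξ' | BadPair κ ξ ξ'} := rfl
    rw [this, Measure.prod_prod]
    refine (mul_le_mul' (rowLaw_badPair_le hκ ξ.1 ξ.2) (rowLaw_badPair_le hκ ξ.1 ξ.2)).trans
      (le_of_eq ?_)
    rw [← ENNReal.ofReal_mul (by positivity), ← ENNReal.ofReal_mul (by positivity)]
    congr 1
    rw [mul_mul_mul_comm, ← mul_pow, ← Real.exp_add, ← mul_inv, Real.mul_self_sqrt hD0.le]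
    congr 2
    ring
  refine (lintegral_mono h1).trans (le_of_eq ?_)
  rw [lintegral_const_mul _ (by fun_prop), rowLaw, lintegral_prod _ (by fun_prop)]
  have hD1 : 1 + 2 * (-(4 / 25) * κ ^ 2 / D) = (1 + 8 / 25 * κ ^ 2) / D := by
    field_simp
    rw [hD]
    ring
  have h2 : ∀ z : 𝓔, ∫⁻ w, ENNReal.ofReal (Real.exp ((-(16 / 25) * κ ^ 2 * ‖z‖ ^ 2 -
        4 / 5 * κ * inner ℝ z w + 4 / 25 * κ ^ 2 * ‖w‖ ^ 2) / D)) ∂stdGaussian 𝓔 =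
      ENNReal.ofReal ((√((1 + 8 / 25 * κ ^ 2) / D))⁻¹ ^ d) *
        ENNReal.ofReal (Real.exp (-(8 / 25 * κ ^ 2 / (1 + 8 / 25 * κ ^ 2)) * ‖z‖ ^ 2)) := by
    intro z
    rw [lintegral_exp_quadratic_stdGaussian_of_eq (α := -(4 / 25) * κ ^ 2 / D)
      (by rw [hD1]; positivity) (-(4 / 5 * κ / D) • z) (-(16 / 25) * κ ^ 2 * ‖z‖ ^ 2 / D), hD1,
      ← ENNReal.ofReal_mul (by positivity)]
    · congr 3
      rw [norm_smul, mul_pow]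
      simp only [Real.norm_eq_abs, sq_abs]
      field_simp
      rw [hD]
      ring
    · intro w
      rw [inner_smul_right, real_inner_comm z w]
      ring
  simp_rw [h2]
  rw [lintegral_const_mul _ (by fun_prop), lintegral_exp_quadratic_stdGaussian_of_eq
    (α := 8 / 25 * κ ^ 2 / (1 + 8 / 25 * κ ^ 2)) (by positivity) 0 0 (by simp),
    ← ENNReal.ofReal_mul (by positivity), ← ENNReal.ofReal_mul (by positivity)]
  congr 1
  simp only [norm_zero, ne_eq, OfNat.ofNat_ne_zero, not_false_eq_true, zero_pow, zero_div,
    add_zero, Real.exp_zero, mul_one]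
  rw [← mul_pow, ← mul_pow, ← mul_pow]
  congr 1
  have hD2 : 1 + 2 * (8 / 25 * κ ^ 2 / (1 + 8 / 25 * κ ^ 2)) =
      (1 + 24 / 25 * κ ^ 2) / (1 + 8 / 25 * κ ^ 2) := by
    field_simp
    ring
  rw [hD2, Real.sqrt_div (by positivity), Real.sqrt_div (by positivity)]
  have : D⁻¹ = (√D)⁻¹ * (√D)⁻¹ := by rw [← mul_inv, Real.mul_self_sqrt hD0.le]
  rw [this]
  field_simp

end PairProbability

/-! ### Comparison of the two rates: q² = O(p³). -/

/-- A one-coordinate inequality raised to the power d. After e^(x/10) ≤ 1 + x/5 with x = A/(1+A),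
two polynomials in A are compared coefficient by coefficient; their linear terms, both 16A/5,
coincide. -/
theorem inv_sqrt_pow_four_le (d : ℕ) {A : ℝ} (hA : 0 ≤ A) :
    ((√(1 + 16 / 25 * A))⁻¹ ^ d * (√(1 + 24 / 25 * A))⁻¹ ^ d) ^ 4 ≤
      ((√(1 + A))⁻¹ ^ d) ^ 6 * Real.exp (-(d * A / (1 + A)) / 10) := by
  have h1 : Real.exp (-(d * A / (1 + A)) / 10) = (Real.exp (A / (1 + A) / 10))⁻¹ ^ d := by
    rw [← Real.exp_neg, ← Real.exp_nat_mul]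
    congr 1
    ring
  rw [h1, ← mul_pow, pow_right_comm, pow_right_comm _ d 6, ← mul_pow]
  gcongr
  rw [← mul_inv, inv_pow, inv_pow, ← mul_inv]
  apply inv_anti₀ (by positivity)
  have e1 : √(1 + A) ^ 6 = (1 + A) ^ 3 := by
    rw [show 6 = 2 * 3 by norm_num, pow_mul, Real.sq_sqrt (by positivity)]
  have e2 : (√(1 + 16 / 25 * A) * √(1 + 24 / 25 * A)) ^ 4 =
      ((1 + 16 / 25 * A) * (1 + 24 / 25 * A)) ^ 2 := by
    rw [show 4 = 2 * 2 by norm_num, pow_mul, mul_pow, Real.sq_sqrt (by positivity),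
      Real.sq_sqrt (by positivity)]
  rw [e1, e2]
  set x := A / (1 + A) with hx
  have hx0 : 0 ≤ x := by positivity
  have hx1 : x ≤ 1 := by rw [hx, div_le_one (by positivity)]; linarith
  have h2 : Real.exp (x / 10) ≤ 1 + x / 5 := by
    have h3 := Real.add_one_le_exp (-(x / 10))
    rw [Real.exp_neg] at h3
    have h4 : Real.exp (x / 10) ≤ (-(x / 10) + 1)⁻¹ := by
      rw [le_inv_comm₀ (Real.exp_pos _) (by linarith)]
      exact h3
    refine h4.trans ?_
    rw [inv_le_iff_one_le_mul₀ (by linarith)]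
    nlinarith
  calc (1 + A) ^ 3 * Real.exp (x / 10) ≤ (1 + A) ^ 3 * (1 + x / 5) := by gcongr
    _ = (1 + A) ^ 2 * (1 + A + A / 5) := by rw [hx]; field_simp
    _ ≤ _ := by
      have := pow_nonneg hA 2
      have := pow_nonneg hA 3
      have := pow_nonneg hA 4
      nlinarith

/-- The exponential gain in q absorbs the polynomial loss in p: (1+√t)² ≤ 4t ≤ 240 e^(B/30), then
cube. -/
theorem one_add_sqrt_pow_six_le {B : ℝ} (hB : 0 ≤ B) :
    (1 + √(2 * B + 4)) ^ 6 * Real.exp (-B / 10) ≤ 240 ^ 3 := by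
  set t := 2 * B + 4 with ht
  have h1 : (1 + √t) ^ 2 ≤ 4 * t := by
    have h2 : √t ^ 2 = t := Real.sq_sqrt (by positivity)
    have h3 : 1 ≤ √t := Real.one_le_sqrt.2 (by linarith)
    nlinarith
  have h4 : t / 60 ≤ Real.exp (B / 30) := by
    have := Real.add_one_le_exp (B / 30)
    linarith
  have h5 : Real.exp (-B / 10) = (Real.exp (B / 30))⁻¹ ^ 3 := by
    rw [← Real.exp_neg, ← Real.exp_nat_mul]
    congr 1
    push_cast
    ring
  rw [h5, show 6 = 2 * 3 by norm_num, pow_mul, ← mul_pow]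
  gcongr
  rw [mul_inv_le_iff₀ (by positivity)]
  linarith

/-- The probability of two bad pairs sharing a row is at most of the order of the power `3 / 2` of
the probability of one bad pair, uniformly in the dimension and the correlation. -/
theorem exists_badProbTwo_sq_le :
    ∃ K : ℝ, 0 < K ∧ ∀ (d : ℕ) (κ : ℝ), 0 ≤ κ → badProbTwo d κ ^ 2 ≤ K * badProb d κ ^ 3 := by
  -- 4000² exceeds the 240³ of the absorption bound, and 2e³ inverts the prefactor in `badProb_ge`.
  refine ⟨4000 * (Real.exp 3 * 2) ^ 3, by positivity, fun d κ hκ => ?_⟩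
  set A := κ ^ 2 with hA
  have hA0 : 0 ≤ A := sq_nonneg κ
  have hp := badProb_ge (d := d) hκ
  have hq := badProbTwo_le (d := d) hκ
  rw [← hA] at hp hq
  set F := (√(1 + A))⁻¹ ^ d with hF
  set G := (√(1 + 16 / 25 * A))⁻¹ ^ d * (√(1 + 24 / 25 * A))⁻¹ ^ d with hG
  set u := 1 + √(2 * (d * A / (1 + A)) + 4) with hu
  have hG0 : 0 ≤ G := by positivity
  have hF0 : 0 ≤ F := by positivity
  have hu0 : 0 < u := by positivity
  have h1 : (G ^ 2) ^ 2 ≤ (4000 * (F / u) ^ 3) ^ 2 := by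
    have h2 := inv_sqrt_pow_four_le d hA0
    have h3 := one_add_sqrt_pow_six_le (B := d * A / (1 + A)) (by positivity)
    rw [← hG, ← hF] at h2
    rw [← hu, mul_comm, ← le_div_iff₀ (by positivity)] at h3
    calc (G ^ 2) ^ 2 = G ^ 4 := by ring
      _ ≤ F ^ 6 * (240 ^ 3 / u ^ 6) := h2.trans (by gcongr)
      _ = 240 ^ 3 * (F / u) ^ 6 := by rw [div_pow]; ring
      _ ≤ 4000 ^ 2 * (F / u) ^ 6 := by gcongr; norm_num
      _ = _ := by ring
  have h4 : G ^ 2 ≤ 4000 * (F / u) ^ 3 := (sq_le_sq₀ (by positivity) (by positivity)).1 h1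
  have h5 : F / u ≤ Real.exp 3 * 2 * badProb d κ := by
    rw [Real.exp_neg] at hp
    rw [← div_le_iff₀' (by positivity)]
    calc _ = (Real.exp 3)⁻¹ / 2 * (F / u) := by field_simp
      _ ≤ _ := hp
  calc badProbTwo d κ ^ 2 ≤ G ^ 2 := by
        gcongr
        exact measureReal_nonneg
    _ ≤ 4000 * (Real.exp 3 * 2 * badProb d κ) ^ 3 := h4.trans (by gcongr)
    _ = _ := by ring

/-- A quadratic Bonferroni-type inequality (the second moment method). -/
theorem second_moment_union_ge {Ω ι : Type*} [MeasurableSpace Ω] (P : Measure Ω)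
    [IsProbabilityMeasure P] (s : Finset ι) (A : ι → Set Ω) (hA : ∀ e, MeasurableSet (A e))
    (U : Set Ω) (hU : MeasurableSet U) (hAU : ∀ e ∈ s, A e ⊆ U) (θ : ℝ) :
    2 * θ * ∑ e ∈ s, P.real (A e) - θ ^ 2 * ∑ e ∈ s, ∑ f ∈ s, P.real (A e ∩ A f) ≤ P.real U := by
  have hi : ∀ S : Set Ω, MeasurableSet S → Integrable (S.indicator (1 : Ω → ℝ)) P := fun S hS =>
    (integrable_const (1 : ℝ)).indicator hS
  have h1 : ∀ ω, 2 * θ * ∑ e ∈ s, (A e).indicator (1 : Ω → ℝ) ω -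
      θ ^ 2 * ∑ e ∈ s, ∑ f ∈ s, (A e ∩ A f).indicator (1 : Ω → ℝ) ω ≤
      U.indicator (1 : Ω → ℝ) ω := by
    intro ω
    have h2 : ∑ e ∈ s, ∑ f ∈ s, (A e ∩ A f).indicator (1 : Ω → ℝ) ω =
        (∑ e ∈ s, (A e).indicator (1 : Ω → ℝ) ω) ^ 2 := by
      rw [sq, Finset.sum_mul_sum]
      simp_rw [Set.inter_indicator_one, Pi.mul_apply]
    rw [h2]
    by_cases hω : ω ∈ U
    · rw [Set.indicator_of_mem hω, Pi.one_apply]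
      -- With N the number of events that occur, 2θN - θ²N² ≤ 1 on U, and N = 0 off U.
      nlinarith [sq_nonneg (1 - θ * ∑ e ∈ s, (A e).indicator (1 : Ω → ℝ) ω)]
    · rw [Set.indicator_of_notMem hω, Finset.sum_eq_zero fun e he =>
        Set.indicator_of_notMem (fun h => hω (hAU e he h)) _]
      simp
  have hs1 : Integrable (fun ω => ∑ e ∈ s, (A e).indicator (1 : Ω → ℝ) ω) P :=
    integrable_finsetSum _ fun e _ => hi _ (hA e)
  have hs2 : Integrable (fun ω => ∑ e ∈ s, ∑ f ∈ s, (A e ∩ A f).indicator (1 : Ω → ℝ) ω) P :=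
    integrable_finsetSum _ fun e _ => integrable_finsetSum _ fun f _ =>
      hi _ ((hA e).inter (hA f))
  have h3 := integral_mono ((hs1.const_mul (2 * θ)).sub (hs2.const_mul (θ ^ 2))) (hi U hU) h1
  simp only [Pi.sub_apply] at h3
  rw [integral_sub (hs1.const_mul _) (hs2.const_mul _), integral_const_mul, integral_const_mul,
    integral_finsetSum _ (fun e _ => hi _ (hA e)), integral_indicator_one hU,
    integral_finsetSum _ (fun e _ => integrable_finsetSum _ fun f _ =>
      hi _ ((hA e).inter (hA f)))] at h3
  simp_rw [integral_indicator_one (hA _)] at h3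
  have h4 : ∀ e, ∫ ω, ∑ f ∈ s, (A e ∩ A f).indicator (1 : Ω → ℝ) ω ∂P =
      ∑ f ∈ s, P.real (A e ∩ A f) := by
    intro e
    rw [integral_finsetSum _ fun f _ => hi _ ((hA e).inter (hA f))]
    simp_rw [integral_indicator_one ((hA e).inter (hA _))]
  simp_rw [h4] at h3
  exact h3

/-! ### Existence of a bad pair by the second moment method. -/

section SecondMoment

variable {n d : ℕ} {κ : ℝ}

local notation "𝓔" => EuclideanSpace ℝ (Fin d)

variable (n d) in
/-- The law of `n` independent rows `(z_i, w_i)`. -/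
noncomputable def rowsLaw : Measure (Fin n → 𝓔 × 𝓔) := Measure.pi fun _ => rowLaw d

instance : IsProbabilityMeasure (rowsLaw n d) := by unfold rowsLaw; infer_instance

theorem iIndepFun_rows : iIndepFun (fun (i : Fin n) (ω : Fin n → 𝓔 × 𝓔) => ω i) (rowsLaw n d) :=
  iIndepFun_pi (X := fun _ x => x) fun _ => aemeasurable_id

theorem map_row (i : Fin n) : (rowsLaw n d).map (fun ω => ω i) = rowLaw d :=
  (measurePreserving_eval (fun _ : Fin n => rowLaw d) i).map_eq

theorem map_two_rows {i j : Fin n} (h : i ≠ j) :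
    (rowsLaw n d).map (fun ω => (ω i, ω j)) = (rowLaw d).prod (rowLaw d) := by
  rw [(indepFun_iff_map_prod_eq_prod_map_map (measurable_pi_apply i).aemeasurable
    (measurable_pi_apply j).aemeasurable).1 (iIndepFun_rows.indepFun h), map_row, map_row]

theorem map_three_rows {i j k : Fin n} (hij : i ≠ j) (hik : i ≠ k) (hjk : j ≠ k) :
    (rowsLaw n d).map (fun ω => (ω i, ω j, ω k)) =
      (rowLaw d).prod ((rowLaw d).prod (rowLaw d)) := by
  have h := (iIndepFun_rows (n := n) (d := d)).indepFun_prodMk (fun i => measurable_pi_apply i)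
    j k i hij.symm hik.symm
  rw [(indepFun_iff_map_prod_eq_prod_map_map (measurable_pi_apply i).aemeasurable
    (by fun_prop)).1 h.symm, map_row,
    map_two_rows hjk]

theorem prob_badPair {i j : Fin n} (h : i ≠ j) :
    (rowsLaw n d).real {ω | BadPair κ (ω i) (ω j)} = badProb d κ := by
  rw [badProb, ← map_two_rows h, map_measureReal_apply (by fun_prop)
    (measurableSet_badPair κ measurable_fst measurable_snd)]
  rfl

theorem prob_badPair_inter_of_common {i j k : Fin n} (hij : i ≠ j) (hik : i ≠ k) (hjk : j ≠ k) :
    (rowsLaw n d).real ({ω | BadPair κ (ω i) (ω j)} ∩ {ω | BadPair κ (ω i) (ω k)}) =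
      badProbTwo d κ := by
  have hms : MeasurableSet {x : (𝓔 × 𝓔) × (𝓔 × 𝓔) × (𝓔 × 𝓔) |
      BadPair κ x.1 x.2.1 ∧ BadPair κ x.1 x.2.2} :=
    (measurableSet_badPair κ (by fun_prop) (by fun_prop)).inter
      (measurableSet_badPair κ (by fun_prop) (by fun_prop))
  rw [badProbTwo, ← map_three_rows hij hik hjk, map_measureReal_apply (by fun_prop) hms]
  rfl

theorem prob_badPair_inter_of_disjoint {i j k l : Fin n} (hij : i ≠ j) (hkl : k ≠ l)
    (hik : i ≠ k) (hil : i ≠ l) (hjk : j ≠ k) (hjl : j ≠ l) :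
    (rowsLaw n d).real ({ω | BadPair κ (ω i) (ω j)} ∩ {ω | BadPair κ (ω k) (ω l)}) =
      badProb d κ ^ 2 := by
  have h := (iIndepFun_rows (n := n) (d := d)).indepFun_prodMk_prodMk
    (fun i => measurable_pi_apply i) i j k l hik hil hjk hjl
  have h2 := h.measure_inter_preimage_eq_mul {x | BadPair κ x.1 x.2} {x | BadPair κ x.1 x.2}
    (measurableSet_badPair κ measurable_fst measurable_snd)
    (measurableSet_badPair κ measurable_fst measurable_snd)
  have h3 := congrArg ENNReal.toReal h2
  rw [ENNReal.toReal_mul] at h3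
  refine h3.trans ?_
  rw [sq]
  exact congrArg₂ _ (prob_badPair hij) (prob_badPair hkl)

/-- The hypotheses describe two edges of a bipartite graph: they coincide, share an endpoint on one
side, or are disjoint and hence independent. The indicators are set up for summation over all pairs
of edges. -/
theorem prob_badPair_inter_le {i j k l : Fin n} (hij : i ≠ j) (hkl : k ≠ l) (hil : i ≠ l)
    (hjk : j ≠ k) :
    (rowsLaw n d).real ({ω | BadPair κ (ω i) (ω j)} ∩ {ω | BadPair κ (ω k) (ω l)}) ≤
      (if i = k then (if j = l then badProb d κ else 0) else 0) +
        (if i = k then badProbTwo d κ else 0) + (if j = l then badProbTwo d κ else 0) +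
        badProb d κ ^ 2 := by
  have hp : 0 ≤ badProb d κ := measureReal_nonneg
  have hq : 0 ≤ badProbTwo d κ := measureReal_nonneg
  by_cases hik : i = k
  · subst hik
    by_cases hjl : j = l
    · subst hjl
      rw [Set.inter_self, prob_badPair hij]
      simp only [if_true]
      nlinarith
    · rw [prob_badPair_inter_of_common hij hil hjl]
      simp only [if_true, hjl, if_false]
      nlinarith
  · by_cases hjl : j = l
    · subst hjl
      have h1 : ∀ a : Fin n, {ω : Fin n → 𝓔 × 𝓔 | BadPair κ (ω a) (ω j)} =
          {ω | BadPair κ (ω j) (ω a)} := fun a =>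
        Set.ext fun ω => ⟨BadPair.symm, BadPair.symm⟩
      rw [h1, h1, prob_badPair_inter_of_common hij.symm hkl.symm hik]
      simp only [if_true, hik, if_false]
      nlinarith
    · rw [prob_badPair_inter_of_disjoint hij hkl hik hil hjk hjl]
      simp [hik, hjl]

theorem prob_exists_badPair_ge (S T : Finset (Fin n)) (hST : Disjoint S T) {m : ℕ}
    (hS : S.card = m) (hT : T.card = m) (U : Set (Fin n → 𝓔 × 𝓔)) (hU : MeasurableSet U)
    (hSTU : ∀ i ∈ S, ∀ j ∈ T, {ω | BadPair κ (ω i) (ω j)} ⊆ U) (θ : ℝ) :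
    2 * θ * (m ^ 2 * badProb d κ) - θ ^ 2 * (m ^ 2 * badProb d κ + 2 * m ^ 3 * badProbTwo d κ +
      (m ^ 2 * badProb d κ) ^ 2) ≤ (rowsLaw n d).real U := by
  have hne : ∀ i ∈ S, ∀ j ∈ T, i ≠ j := fun i hi j hj => Finset.disjoint_iff_ne.1 hST i hi j hj
  have h := second_moment_union_ge (rowsLaw n d) (S ×ˢ T)
    (fun e => {ω | BadPair κ (ω e.1) (ω e.2)})
    (fun e => measurableSet_badPair κ (by fun_prop) (by fun_prop)) U hU
    (fun e he => hSTU e.1 (Finset.mem_product.1 he).1 e.2 (Finset.mem_product.1 he).2) θ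
  refine le_trans ?_ h
  have h1 : ∑ e ∈ S ×ˢ T, (rowsLaw n d).real {ω | BadPair κ (ω e.1) (ω e.2)} =
      m ^ 2 * badProb d κ := by
    rw [Finset.sum_congr rfl fun e he => prob_badPair (hne e.1 (Finset.mem_product.1 he).1 e.2
      (Finset.mem_product.1 he).2)]
    simp [hS, hT, sq]
  have h2 : ∑ e ∈ S ×ˢ T, ∑ f ∈ S ×ˢ T, (rowsLaw n d).real
      ({ω | BadPair κ (ω e.1) (ω e.2)} ∩ {ω | BadPair κ (ω f.1) (ω f.2)}) ≤
      m ^ 2 * badProb d κ + 2 * m ^ 3 * badProbTwo d κ + (m ^ 2 * badProb d κ) ^ 2 := by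
    calc _ ≤ ∑ e ∈ S ×ˢ T, ∑ f ∈ S ×ˢ T,
          ((if e.1 = f.1 then (if e.2 = f.2 then badProb d κ else 0) else 0) +
          (if e.1 = f.1 then badProbTwo d κ else 0) + (if e.2 = f.2 then badProbTwo d κ else 0) +
          badProb d κ ^ 2) := by
          refine Finset.sum_le_sum fun e he => Finset.sum_le_sum fun f hf => ?_
          rw [Finset.mem_product] at he hf
          exact prob_badPair_inter_le (hne _ he.1 _ he.2) (hne _ hf.1 _ hf.2) (hne _ he.1 _ hf.2)
            (hne _ hf.1 _ he.2).symm
      _ = ∑ e ∈ S ×ˢ T, (badProb d κ + 2 * (m * badProbTwo d κ) + m ^ 2 * badProb d κ ^ 2) := by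
          refine Finset.sum_congr rfl fun e he => ?_
          rw [Finset.mem_product] at he
          have e1 : ∀ b : ℝ, ∑ i ∈ S, (if e.1 = i then b else 0) = b := fun b => by
            rw [Finset.sum_ite_eq, if_pos he.1]
          have e2 : ∀ b : ℝ, ∑ j ∈ T, (if e.2 = j then b else 0) = b := fun b => by
            rw [Finset.sum_ite_eq, if_pos he.2]
          simp only [Finset.sum_add_distrib, Finset.sum_const, Finset.card_product, hS, hT]
          rw [Finset.sum_product, Finset.sum_product_right, Finset.sum_product]
          simp only [e1, e2, Finset.sum_const, hS, hT, nsmul_eq_mul]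
          have e3 : ∑ i ∈ S, ∑ j ∈ T, (if e.1 = i then (if e.2 = j then badProb d κ else 0) else 0) =
              badProb d κ := by
            refine (Finset.sum_congr rfl fun i _ => ?_).trans (e1 (badProb d κ))
            split_ifs
            · exact e2 _
            · exact Finset.sum_const_zero
          rw [e3]
          push_cast
          ring
      _ = _ := by
          simp only [Finset.sum_const, Finset.card_product, hS, hT, nsmul_eq_mul]
          push_cast
          ring
  rw [h1]
  have := mul_le_mul_of_nonneg_left h2 (sq_nonneg θ)
  linarith

/-- If the expected number of bad pairs is bounded below, then a bad pair exists with probability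
bounded below. -/
theorem exists_prob_exists_badPair_ge {c : ℝ} (hc : 0 < c) :
    ∃ δ : ℝ, 0 < δ ∧ ∀ (n d m : ℕ) (κ : ℝ), 0 ≤ κ → ∀ S T : Finset (Fin n), Disjoint S T →
      S.card = m → T.card = m → c ≤ m ^ 2 * badProb d κ →
      ∀ U : Set (Fin n → EuclideanSpace ℝ (Fin d) × EuclideanSpace ℝ (Fin d)), MeasurableSet U →
      (∀ i ∈ S, ∀ j ∈ T, {ω | BadPair κ (ω i) (ω j)} ⊆ U) → δ ≤ (rowsLaw n d).real U := by
  obtain ⟨K, hK, hKq⟩ := exists_badProbTwo_sq_le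
  refine ⟨(1 / c + 2 * √(K / c) + 1)⁻¹, by positivity, ?_⟩
  intro n d m κ hκ S T hST hS hT hx U hU hSTU
  have h := prob_exists_badPair_ge S T hST hS hT U hU hSTU
  have hp : 0 ≤ badProb d κ := measureReal_nonneg
  have hq : 0 ≤ badProbTwo d κ := measureReal_nonneg
  have hK2 := hKq d κ hκ
  set p := badProb d κ
  set q := badProbTwo d κ
  set x := m ^ 2 * p with hxdef
  have hx0 : 0 < x := hc.trans_le hx
  have h1 : x ≤ x ^ 2 * (1 / c) := by
    rw [mul_one_div, le_div_iff₀ hc]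
    nlinarith
  -- Since q² ≤ Kp³, the square of the left side is at most Kx³, and x ≥ c turns x³ into x⁴/c.
  have h2 : m ^ 3 * q ≤ x ^ 2 * √(K / c) := by
    refine abs_le_of_sq_le_sq' ?_ (by positivity) |>.2
    rw [mul_pow, mul_pow, Real.sq_sqrt (by positivity)]
    calc ((m : ℝ) ^ 3) ^ 2 * q ^ 2 ≤ (m ^ 3) ^ 2 * (K * p ^ 3) := by gcongr
      _ = K * x ^ 3 := by rw [hxdef]; ring
      _ ≤ K * (x ^ 3 * (x / c)) := by
        gcongr
        exact le_mul_of_one_le_right (by positivity) ((one_le_div hc).2 hx)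
      _ = _ := by ring
  set L := 1 / c + 2 * √(K / c) + 1 with hL
  have hL0 : 0 < L := by positivity
  -- The second moment is at most x²L, and this θ maximises 2θx - θ²x²L, with value 1/L.
  refine le_trans ?_ (h (x * L)⁻¹)
  have h3 : x + 2 * m ^ 3 * q + x ^ 2 ≤ x ^ 2 * L := by rw [hL]; nlinarith
  calc L⁻¹ = 2 * (x * L)⁻¹ * x - (x * L)⁻¹ ^ 2 * (x ^ 2 * L) := by field_simp; ring
    _ ≤ _ := by gcongr

end SecondMoment

/-! ### Change of the hidden permutation and the error of an estimator. -/

section ErrorBound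

open CGMM

variable {n d : ℕ}

/-- The law of the permutation and the noises, without the labels. -/
noncomputable def permNoiseLaw (n d : ℕ) :
    Measure (Equiv.Perm (Fin n) × Database n d × Database n d) :=
  (PMF.uniformOfFintype (Equiv.Perm (Fin n))).toMeasure.prod
    ((gaussianDatabase n d).prod (gaussianDatabase n d))

instance : IsProbabilityMeasure (gaussianDatabase n d) := by
  unfold gaussianDatabase; infer_instance

instance : IsProbabilityMeasure (permNoiseLaw n d) := by unfold permNoiseLaw; infer_instance

/-- The shift of the noise `w` compensating a change of the hidden permutation by `τ`. -/
def noiseShift (κ : ℝ) (τ : Equiv.Perm (Fin n)) (z : Database n d) : Database n d :=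
  fun i => κ • (z (τ i) - z i)

/-- The change of the latent randomness replacing `π` by `π * τ` and keeping both databases. -/
def relabel (κ : ℝ) (τ : Equiv.Perm (Fin n))
    (ω : Equiv.Perm (Fin n) × Database n d × Database n d) :
    Equiv.Perm (Fin n) × Database n d × Database n d :=
  (ω.1 * τ, ω.2.1, (fun i => ω.2.2 (τ i)) + noiseShift κ τ ω.2.1)

/-- The log-likelihood ratio of `π * τ` against `π`. -/
noncomputable def logRatio (κ : ℝ) (τ : Equiv.Perm (Fin n)) (x : Database n d × Database n d) : ℝ :=
  ∑ i, (inner ℝ (noiseShift κ τ x.1 i) (x.2 i) - ‖noiseShift κ τ x.1 i‖ ^ 2 / 2)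

@[fun_prop]
theorem measurable_noiseShift (κ : ℝ) (τ : Equiv.Perm (Fin n)) :
    Measurable (noiseShift (d := d) κ τ) := by
  unfold noiseShift
  fun_prop

@[fun_prop]
theorem measurable_logRatio (κ : ℝ) (τ : Equiv.Perm (Fin n)) :
    Measurable (logRatio (d := d) κ τ) := by
  unfold logRatio
  fun_prop

theorem measurable_relabel (κ : ℝ) (τ : Equiv.Perm (Fin n)) :
    Measurable (relabel (d := d) κ τ) := by
  unfold relabel
  refine Measurable.prodMk ?_ (by fun_prop)
  exact (measurable_from_top (f := fun π : Equiv.Perm (Fin n) => π * τ)).comp measurable_fst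

theorem uniformPerm_map_mul_right (τ : Equiv.Perm (Fin n)) :
    (PMF.uniformOfFintype (Equiv.Perm (Fin n))).toMeasure.map (fun π => π * τ) =
      (PMF.uniformOfFintype (Equiv.Perm (Fin n))).toMeasure := by
  have hm : Measurable fun π : Equiv.Perm (Fin n) => π * τ := measurable_from_top
  rw [PMF.toMeasure_map _ _ hm]
  congr 1
  ext π
  rw [PMF.map_apply, tsum_eq_single (π * τ⁻¹)]
  · simp
  · intro b hb
    rw [if_neg]
    rintro rfl
    simp at hb

theorem gaussianDatabase_map_perm (τ : Equiv.Perm (Fin n)) :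
    (gaussianDatabase n d).map (fun w i => w (τ i)) = gaussianDatabase n d := by
  refine (Measure.pi_eq fun s hs => ?_).symm
  rw [Measure.map_apply (by fun_prop) (MeasurableSet.univ_pi hs)]
  have : (fun (w : Database n d) i => w (τ i)) ⁻¹' Set.univ.pi s =
      Set.univ.pi fun i => s (τ.symm i) := by
    ext w
    simp only [Set.mem_preimage, Set.mem_pi, Set.mem_univ, true_implies]
    exact ⟨fun h i => by simpa using h (τ.symm i), fun h i => by simpa using h (τ i)⟩
  rw [this, gaussianDatabase, Measure.pi_pi]
  exact Equiv.prod_comp τ.symm fun i => stdGaussian (EuclideanSpace ℝ (Fin d)) (s i)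

/-- Right multiplication by τ preserves the uniform law, permuting rows preserves the law of w, and
for fixed z the remaining shift of w is given by Cameron–Martin. -/
theorem lintegral_comp_relabel (κ : ℝ) (τ : Equiv.Perm (Fin n))
    (F : Equiv.Perm (Fin n) × Database n d × Database n d → ENNReal) (hF : Measurable F) :
    ∫⁻ ω, F (relabel κ τ ω) ∂permNoiseLaw n d =
      ∫⁻ ω, ENNReal.ofReal (Real.exp (logRatio κ τ ω.2)) * F ω ∂permNoiseLaw n d := by
  have hτ : Measurable fun π : Equiv.Perm (Fin n) => π * τ := measurable_from_top
  have h1 : ∀ π z, ∫⁻ w, F (relabel κ τ (π, z, w)) ∂gaussianDatabase n d =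
      ∫⁻ w, ENNReal.ofReal (Real.exp (logRatio κ τ (z, w))) * F (π * τ, z, w)
        ∂gaussianDatabase n d := by
    intro π z
    have hFz : Measurable fun w => F (π * τ, z, w) := hF.comp (by fun_prop)
    have hFz' : Measurable fun w => F (π * τ, z, w + noiseShift κ τ z) := hF.comp (by fun_prop)
    have h2 : ∫⁻ w, F (relabel κ τ (π, z, w)) ∂gaussianDatabase n d =
        ∫⁻ w, F (π * τ, z, w + noiseShift κ τ z) ∂gaussianDatabase n d := by
      conv_rhs => rw [← gaussianDatabase_map_perm τ]
      rw [lintegral_map hFz' (by fun_prop)]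
      rfl
    rw [h2, ← lintegral_map hFz (by fun_prop), gaussianDatabase_map_add_eq_withDensity,
      lintegral_withDensity_eq_lintegral_mul _ (by fun_prop) hFz]
    rfl
  have hrl : Measurable fun ω => F (relabel κ τ ω) := hF.comp (measurable_relabel κ τ)
  have hG : Measurable fun ω : Equiv.Perm (Fin n) × Database n d × Database n d =>
      ENNReal.ofReal (Real.exp (logRatio κ τ ω.2)) * F ω :=
    ((measurable_logRatio κ τ).comp measurable_snd).exp.ennreal_ofReal.mul hF
  have hrl' : ∀ π, Measurable fun x : Database n d × Database n d => F (relabel κ τ (π, x)) :=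
    fun π => hrl.comp measurable_prodMk_left
  have hG' : ∀ π, Measurable fun x : Database n d × Database n d =>
      ENNReal.ofReal (Real.exp (logRatio κ τ x)) * F (π, x) := fun π =>
    (measurable_logRatio κ τ).exp.ennreal_ofReal.mul (hF.comp measurable_prodMk_left)
  unfold permNoiseLaw
  rw [lintegral_prod _ hrl.aemeasurable, lintegral_prod _ hG.aemeasurable]
  conv_rhs => rw [← uniformPerm_map_mul_right τ]
  rw [lintegral_map (Measurable.lintegral_prod_right' hG) hτ]
  refine lintegral_congr fun π => ?_
  rw [lintegral_prod _ (hrl' π).aemeasurable, lintegral_prod _ (hG' (π * τ)).aemeasurable]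
  exact lintegral_congr fun z => h1 π z

theorem databaseX_relabel (μ : EuclideanSpace ℝ (Fin d)) (κ : ℝ) (τ : Equiv.Perm (Fin n))
    (σ : Labels n) (ω : Equiv.Perm (Fin n) × Database n d × Database n d) :
    databaseX μ (σ, relabel κ τ ω) = databaseX μ (σ, ω) := rfl

/-- As √(1-ρ²)κ = ρ, the shift replaces ρ `z j` by ρ `z (τ j)`, so the new row j of Y' is the old
row τ j; equality of labels is needed for the means to agree. -/
theorem databaseY_relabel (μ : EuclideanSpace ℝ (Fin d)) {ρ : ℝ} (hρ : ρ ^ 2 < 1)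
    (τ : Equiv.Perm (Fin n)) (σ : Labels n) (hτ : ∀ i, σ (τ i) = σ i)
    (ω : Equiv.Perm (Fin n) × Database n d × Database n d) :
    databaseY μ ρ (σ, relabel (ρ / √(1 - ρ ^ 2)) τ ω) = databaseY μ ρ (σ, ω) := by
  obtain ⟨π, z, w⟩ := ω
  funext k
  have hs : √(1 - ρ ^ 2) ≠ 0 := (Real.sqrt_pos.2 (by linarith)).ne'
  obtain ⟨j, hj⟩ : ∃ j, τ j = π.symm k := ⟨τ.symm (π.symm k), by simp⟩
  have h1 : (π * τ).symm k = j := by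
    rw [Equiv.symm_apply_eq, Equiv.Perm.mul_apply, hj, Equiv.apply_symm_apply]
  simp only [databaseY, databaseY', relabel, h1, ← hj, Pi.add_apply, noiseShift, hτ, smul_add,
    smul_smul, mul_div_cancel₀ _ hs]
  rw [smul_sub]
  abel

theorem badPair_imp_logRatio_nonneg {κ : ℝ} (hκ : 0 ≤ κ) {i j : Fin n} (hij : i ≠ j)
    {z w : Database n d} (h : BadPair κ (z i, w i) (z j, w j)) :
    0 ≤ logRatio κ (Equiv.swap i j) (z, w) := by
  have h1 : logRatio κ (Equiv.swap i j) (z, w) =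
      -κ * inner ℝ (z i - z j) (κ • (z i - z j) + (w i - w j)) := by
    unfold logRatio
    rw [Fintype.sum_eq_add i j hij]
    · simp only [noiseShift, Equiv.swap_apply_left, Equiv.swap_apply_right]
      rw [← neg_sub (z i) (z j), smul_neg, norm_neg, inner_neg_left, norm_smul, mul_pow,
        inner_smul_left, inner_smul_left, inner_add_right, inner_smul_right,
        real_inner_self_eq_norm_sq, inner_sub_right]
      simp only [conj_trivial, Real.norm_eq_abs, sq_abs]
      ring
    · intro k hk
      simp [noiseShift, Equiv.swap_apply_of_ne_of_ne hk.1 hk.2]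
  rw [h1]
  exact mul_nonneg_of_nonpos_of_nonpos (by linarith) h

theorem measurable_label (i : Fin n) : Measurable fun σ : Labels n => ((σ i : ℤ) : ℝ) := by
  have h1 : Measurable (fun u : ℤˣ => (u : ℤ)) := comap_measurable _
  exact (measurable_of_countable (fun k : ℤ => (k : ℝ))).comp (h1.comp (measurable_pi_apply i))

theorem measurable_databases (μ : EuclideanSpace ℝ (Fin d)) (ρ : ℝ) :
    Measurable fun ω : Latent n d => (databaseX μ ω, databaseY μ ρ ω) := by
  have hl : ∀ i, Measurable fun ω : Latent n d => ((ω.1 i : ℤ) : ℝ) := fun i =>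
    (measurable_label i).comp measurable_fst
  refine Measurable.prodMk (measurable_pi_lambda _ fun i => ?_) (measurable_pi_lambda _ fun i => ?_)
  · have := hl i
    change Measurable fun ω : Latent n d => ((ω.1 i : ℤ) : ℝ) • μ + ω.2.2.1 i
    fun_prop
  · have h1 : Measurable fun x : Fin n × Latent n d => databaseY' μ ρ x.2 x.1 := by
      refine measurable_from_prod_countable_right fun j => ?_
      have := hl j
      change Measurable fun ω : Latent n d =>
        ((ω.1 j : ℤ) : ℝ) • μ + ρ • ω.2.2.1 j + √(1 - ρ ^ 2) • ω.2.2.2 j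
      fun_prop
    have h2 : Measurable fun π : Equiv.Perm (Fin n) => π.symm i := measurable_from_top
    have h3 : Measurable fun ω : Latent n d => (ω.2.1.symm i, ω) :=
      Measurable.prodMk (h2.comp (measurable_fst.comp measurable_snd)) measurable_id
    exact Measurable.comp (g := fun x : Fin n × Latent n d => databaseY' μ ρ x.2 x.1)
      (f := fun ω : Latent n d => (ω.2.1.symm i, ω)) h1 h3

theorem measurableSet_exactMatching (μ : EuclideanSpace ℝ (Fin d)) (ρ : ℝ)
    {est : Database n d × Database n d → Equiv.Perm (Fin n)} (hest : Measurable est) :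
    MeasurableSet {ω : Latent n d | est (databaseX μ ω, databaseY μ ρ ω) = ω.2.1} := by
  have h1 : Measurable fun ω : Latent n d =>
      (est (databaseX μ ω, databaseY μ ρ ω), ω.2.1) :=
    (hest.comp (measurable_databases μ ρ)).prodMk (by fun_prop)
  have h2 : MeasurableSet {x : Equiv.Perm (Fin n) × Equiv.Perm (Fin n) | x.1 = x.2} :=
    (Set.toFinite _).measurableSet
  exact h1 h2

/-- If with some probability a permutation preserving the labels makes the data at least as likely
as the hidden one does, then the estimator errs with at least half that probability. -/
theorem prob_le_two_mul_prob_error (μ : EuclideanSpace ℝ (Fin d)) {ρ : ℝ} (hρ : ρ ^ 2 < 1)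
    (σ : Labels n) {est : Database n d × Database n d → Equiv.Perm (Fin n)} (hest : Measurable est) :
    permNoiseLaw n d {ω | ∃ τ, τ ≠ 1 ∧ (∀ i, σ (τ i) = σ i) ∧
        0 ≤ logRatio (ρ / √(1 - ρ ^ 2)) τ ω.2} ≤
      2 * permNoiseLaw n d
        {ω | est (databaseX μ (σ, ω), databaseY μ ρ (σ, ω)) = ω.1}ᶜ := by
  classical
  set κ := ρ / √(1 - ρ ^ 2) with hκ
  set C := {ω : Equiv.Perm (Fin n) × Database n d × Database n d |
    est (databaseX μ (σ, ω), databaseY μ ρ (σ, ω)) = ω.1} with hC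
  have hCm : MeasurableSet C := measurable_prodMk_left (measurableSet_exactMatching μ ρ hest)
  set G := Finset.univ.filter fun τ : Equiv.Perm (Fin n) => τ ≠ 1 ∧ ∀ i, σ (τ i) = σ i with hG
  set B := fun τ : Equiv.Perm (Fin n) =>
    C ∩ {ω : Equiv.Perm (Fin n) × Database n d × Database n d | 0 ≤ logRatio κ τ ω.2} with hB
  have hBm : ∀ τ, MeasurableSet (B τ) := fun τ =>
    hCm.inter (measurableSet_le measurable_const (by fun_prop))
  -- On `B τ` the density is at least 1, so its probability is at most that of its preimage under
  -- `relabel κ τ`. These preimages are pairwise disjoint and lie in the error event.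
  have h1 : permNoiseLaw n d (⋃ τ ∈ G, B τ) ≤ permNoiseLaw n d Cᶜ := by
    calc permNoiseLaw n d (⋃ τ ∈ G, B τ) ≤ ∑ τ ∈ G, permNoiseLaw n d (B τ) :=
          measure_biUnion_finset_le _ _
      _ ≤ ∑ τ ∈ G, ∫⁻ ω, (B τ).indicator 1 (relabel κ τ ω) ∂permNoiseLaw n d := by
          refine Finset.sum_le_sum fun τ _ => ?_
          rw [lintegral_comp_relabel κ τ _ (measurable_one.indicator (hBm τ)),
            ← lintegral_indicator_one (hBm τ)]
          refine lintegral_mono fun ω => ?_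
          by_cases hω : ω ∈ B τ
          · rw [Set.indicator_of_mem hω, Pi.one_apply, mul_one]
            simpa using hω.2
          · simp [Set.indicator_of_notMem hω]
      _ = ∫⁻ ω, ∑ τ ∈ G, (B τ).indicator 1 (relabel κ τ ω) ∂permNoiseLaw n d :=
          (lintegral_finsetSum _ fun τ _ =>
            (measurable_one.indicator (hBm τ)).comp (measurable_relabel κ τ)).symm
      _ ≤ ∫⁻ ω, Cᶜ.indicator 1 ω ∂permNoiseLaw n d := by
          refine lintegral_mono fun ω => ?_
          -- The estimator sees the same data before and after relabelling, so its output is ω.1 *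
          -- τ: this determines τ, and it is an error because τ ≠ 1.
          have h2 : ∀ τ ∈ G, relabel κ τ ω ∈ B τ →
              est (databaseX μ (σ, ω), databaseY μ ρ (σ, ω)) = ω.1 * τ := by
            intro τ hτ hω
            have h3 := hω.1
            rw [hC, Set.mem_ofPred_eq, databaseX_relabel,
              databaseY_relabel μ hρ τ σ (Finset.mem_filter.1 hτ).2.2] at h3
            exact h3
          by_cases hω : ω ∈ C
          · rw [Finset.sum_eq_zero fun τ hτ => Set.indicator_of_notMem (fun h => ?_) _]
            · exact zero_le
            · have h3 := h2 τ hτ h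
              rw [show est _ = ω.1 from hω] at h3
              exact (Finset.mem_filter.1 hτ).2.1 (mul_eq_left.1 h3.symm)
          · rw [Set.indicator_of_mem hω, Pi.one_apply]
            calc ∑ τ ∈ G, (B τ).indicator 1 (relabel κ τ ω) ≤ ∑ τ ∈ G,
                  if ω.1⁻¹ * est (databaseX μ (σ, ω), databaseY μ ρ (σ, ω)) = τ
                    then (1 : ENNReal) else 0 := by
                  refine Finset.sum_le_sum fun τ hτ => ?_
                  by_cases h : relabel κ τ ω ∈ B τ
                  · rw [if_pos (by rw [h2 τ hτ h, inv_mul_cancel_left]), Set.indicator_of_mem h,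
                      Pi.one_apply]
                  · rw [Set.indicator_of_notMem h]
                    exact zero_le
              _ ≤ 1 := by
                  rw [Finset.sum_ite_eq]
                  split_ifs <;> simp
      _ = permNoiseLaw n d Cᶜ := lintegral_indicator_one hCm.compl
  calc _ ≤ permNoiseLaw n d ((⋃ τ ∈ G, B τ) ∪ Cᶜ) := by
        refine measure_mono fun ω hω => ?_
        obtain ⟨τ, hτ1, hτσ, hτ⟩ := hω
        by_cases hωC : ω ∈ C
        · left
          exact Set.mem_biUnion (Finset.mem_coe.2 (by simp [hG, hτ1, hτσ])) ⟨hωC, hτ⟩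
        · right
          exact hωC
    _ ≤ _ := (measure_union_le _ _).trans ((add_le_add_left h1 _).trans (two_mul _).symm.le)

end ErrorBound

/-! ### From the threshold conditions to a uniform error bound. -/

section Impossibility

open CGMM

/-- By pigeonhole one label occurs at least n/2 times; swaps between S and T then preserve σ. -/
theorem exists_disjoint_subsets_same_label {n : ℕ} (σ : Labels n) :
    ∃ S T : Finset (Fin n), Disjoint S T ∧ S.card = n / 4 ∧ T.card = n / 4 ∧
      ∀ i ∈ S, ∀ j ∈ T, σ i = σ j := by
  classical
  obtain ⟨u, hu⟩ : ∃ u : ℤˣ, n / 4 + n / 4 ≤ (Finset.univ.filter fun i => σ i = u).card := by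
    by_contra! h
    have h1 := h 1
    have h2 := h (-1)
    have h3 := Finset.card_filter_add_card_filter_not (s := Finset.univ) fun i : Fin n => σ i = 1
    have h4 : (Finset.univ.filter fun i => ¬ σ i = 1) = Finset.univ.filter fun i => σ i = -1 :=
      Finset.filter_congr fun i _ => by
        rcases Int.units_eq_one_or (σ i) with h | h <;> simp [h]
    rw [h4, Finset.card_univ, Fintype.card_fin] at h3
    omega
  obtain ⟨V, hV, hVc⟩ := Finset.exists_subset_card_eq hu
  obtain ⟨S, hS, hSc⟩ := Finset.exists_subset_card_eq (s := V) (n := n / 4) (by omega)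
  refine ⟨S, V \ S, Finset.disjoint_sdiff, hSc, ?_, fun i hi j hj => ?_⟩
  · rw [Finset.card_sdiff_of_subset hS]
    omega
  · have h1 := (Finset.mem_filter.1 (hV (hS hi))).2
    have h2 := (Finset.mem_filter.1 (hV (Finset.mem_sdiff.1 hj).1)).2
    rw [h1, h2]

theorem rowsLaw_map_unzip (n d : ℕ) :
    (rowsLaw n d).map (fun ω => ((fun i => (ω i).1, fun i => (ω i).2) :
      Database n d × Database n d)) = (gaussianDatabase n d).prod (gaussianDatabase n d) :=
  (measurePreserving_arrowProdEquivProdArrow (EuclideanSpace ℝ (Fin d))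
    (EuclideanSpace ℝ (Fin d)) (Fin n) (fun _ => stdGaussian (EuclideanSpace ℝ (Fin d)))
    (fun _ => stdGaussian (EuclideanSpace ℝ (Fin d)))).map_eq

/-- If the expected number of bad pairs is bounded below, then every estimator errs with
probability bounded below. -/
theorem exists_exactMatchingProb_le {c : ℝ} (hc : 0 < c) :
    ∃ δ : ℝ, 0 < δ ∧ ∀ (n d : ℕ) (μ : EuclideanSpace ℝ (Fin d)) (ρ : ℝ) (ν : PMF (Labels n))
      (est : Database n d × Database n d → Equiv.Perm (Fin n)), Measurable est → 0 ≤ ρ → ρ < 1 →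
      8 ≤ n → c ≤ n ^ 2 * badProb d (ρ / √(1 - ρ ^ 2)) →
      exactMatchingProb n d μ ρ ν est ≤ 1 - δ := by
  -- The integer part of n/4 is at least n/8, so passing from n² to its square costs a factor 64.
  obtain ⟨δ, hδ, h⟩ := exists_prob_exists_badPair_ge (c := c / 64) (by positivity)
  refine ⟨δ / 2, by positivity, ?_⟩
  intro n d μ ρ ν est hest hρ0 hρ1 hn hcn
  set κ := ρ / √(1 - ρ ^ 2) with hκdef
  have hκ : 0 ≤ κ := by positivity
  have hρ2 : ρ ^ 2 < 1 := by nlinarith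
  have herr : ∀ σ : Labels n, ENNReal.ofReal (δ / 2) ≤ permNoiseLaw n d
      {ω | est (databaseX μ (σ, ω), databaseY μ ρ (σ, ω)) = ω.1}ᶜ := by
    intro σ
    obtain ⟨S, T, hST, hS, hT, hσ⟩ := exists_disjoint_subsets_same_label σ
    set V : Set (Database n d × Database n d) :=
      {x | ∃ τ : Equiv.Perm (Fin n), τ ≠ 1 ∧ (∀ i, σ (τ i) = σ i) ∧ 0 ≤ logRatio κ τ x} with hV
    have hVm : MeasurableSet V := by
      have : V = ⋃ τ ∈ {τ : Equiv.Perm (Fin n) | τ ≠ 1 ∧ ∀ i, σ (τ i) = σ i},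
          {x | 0 ≤ logRatio κ τ x} := by
        ext x
        simp [hV, and_assoc]
      rw [this]
      exact MeasurableSet.biUnion (Set.to_countable _) fun τ _ =>
        measurableSet_le measurable_const (measurable_logRatio κ τ)
    have hm : (n : ℝ) / 8 ≤ ((n / 4 : ℕ) : ℝ) := by
      rw [div_le_iff₀ (by norm_num)]
      have : n ≤ n / 4 * 8 := by omega
      exact_mod_cast this
    have hp : 0 ≤ badProb d κ := measureReal_nonneg
    have hunzip : Measurable fun ω : Fin n → EuclideanSpace ℝ (Fin d) × EuclideanSpace ℝ (Fin d) =>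
        ((fun i => (ω i).1, fun i => (ω i).2) : Database n d × Database n d) := by fun_prop
    have h1 := h n d (n / 4) κ hκ S T hST hS hT
      (by
        calc c / 64 ≤ (n / 8 : ℝ) ^ 2 * badProb d κ := by linarith
          _ ≤ _ := by gcongr)
      ((fun ω => ((fun i => (ω i).1, fun i => (ω i).2) : Database n d × Database n d)) ⁻¹' V)
      (hunzip hVm) (by
        intro i hi j hj ω hω
        have hij : i ≠ j := Finset.disjoint_iff_ne.1 hST i hi j hj
        refine ⟨Equiv.swap i j, by simpa using hij, fun k => ?_,
          badPair_imp_logRatio_nonneg hκ hij hω⟩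
        by_cases hki : k = i
        · rw [hki, Equiv.swap_apply_left, hσ i hi j hj]
        · by_cases hkj : k = j
          · rw [hkj, Equiv.swap_apply_right, hσ i hi j hj]
          · rw [Equiv.swap_apply_of_ne_of_ne hki hkj])
    rw [← map_measureReal_apply hunzip hVm, rowsLaw_map_unzip] at h1
    have h2 : permNoiseLaw n d (Prod.snd ⁻¹' V) =
        ((gaussianDatabase n d).prod (gaussianDatabase n d)) V := by
      have : (Prod.snd ⁻¹' V : Set (Equiv.Perm (Fin n) × Database n d × Database n d)) =
          Set.univ ×ˢ V := by ext; simp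
      rw [this, permNoiseLaw, Measure.prod_prod, measure_univ, one_mul]
    have h3 := prob_le_two_mul_prob_error μ hρ2 σ hest
    have h4 : ENNReal.ofReal δ ≤ permNoiseLaw n d (Prod.snd ⁻¹' V) := by
      rw [h2]
      exact ENNReal.ofReal_le_of_le_toReal h1
    have h5 := h4.trans h3
    rw [ENNReal.ofReal_div_of_pos (by norm_num), ENNReal.ofReal_ofNat]
    exact ENNReal.div_le_of_le_mul' h5
  have hCm := measurableSet_exactMatching μ ρ hest
  have hprob : IsProbabilityMeasure (latentLaw n d ν) := by unfold latentLaw; infer_instance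
  have h6 : ENNReal.ofReal (δ / 2) ≤ latentLaw n d ν
      {ω | est (databaseX μ ω, databaseY μ ρ ω) = ω.2.1}ᶜ := by
    rw [latentLaw, Measure.prod_apply hCm.compl]
    calc ENNReal.ofReal (δ / 2) = ∫⁻ σ, ENNReal.ofReal (δ / 2) ∂ν.toMeasure := by simp
      _ ≤ _ := lintegral_mono fun σ => herr σ
  have h7 : δ / 2 ≤ (latentLaw n d ν).real
      {ω | est (databaseX μ ω, databaseY μ ρ ω) = ω.2.1}ᶜ :=
    (ENNReal.ofReal_le_iff_le_toReal (measure_ne_top _ _)).1 h6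
  rw [probReal_compl_eq_one_sub hCm] at h7
  unfold exactMatchingProb
  linarith

/-- Since 1 + κ² = 1/(1-ρ²), the main factor is the exponential of -2 times the quantity in the
thresholds. The denominator is bounded crudely, linearly in d, which both regimes can afford. -/
theorem badProb_ge_exp (d : ℕ) {ρ : ℝ} (hρ0 : 0 ≤ ρ) (hρ1 : ρ < 1) :
    Real.exp (-3) / 2 * (Real.exp (-2 * ((d : ℝ) / 4 * Real.log (1 / (1 - ρ ^ 2)))) /
      (2 * d + 5)) ≤ badProb d (ρ / √(1 - ρ ^ 2)) := by
  have hρ2 : 0 < 1 - ρ ^ 2 := by nlinarith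
  refine le_trans ?_ (badProb_ge (by positivity))
  have h1 : (ρ / √(1 - ρ ^ 2)) ^ 2 = ρ ^ 2 / (1 - ρ ^ 2) := by
    rw [div_pow, Real.sq_sqrt hρ2.le]
  rw [h1]
  set A := ρ ^ 2 / (1 - ρ ^ 2) with hA
  have hA0 : 0 ≤ A := by positivity
  have h2 : 1 / (1 - ρ ^ 2) = 1 + A := by rw [hA]; field_simp; ring
  have h3 : Real.exp (-2 * ((d : ℝ) / 4 * Real.log (1 / (1 - ρ ^ 2)))) = (√(1 + A))⁻¹ ^ d := by
    rw [h2, ← Real.exp_log (show 0 < (√(1 + A))⁻¹ by positivity), ← Real.exp_nat_mul, Real.log_inv,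
      Real.log_sqrt (by positivity)]
    congr 1
    ring
  rw [h3]
  have h4 : d * A / (1 + A) ≤ d := by
    rw [div_le_iff₀ (by positivity)]
    have : (0 : ℝ) ≤ d := by positivity
    nlinarith
  have h5 : √(2 * (d * A / (1 + A)) + 4) ≤ 2 * d + 4 := by
    rw [Real.sqrt_le_left (by positivity)]
    have : (0 : ℝ) ≤ d := by positivity
    nlinarith
  gcongr _ * (_ / ?_)
  linarith

/-- The slack ε gives a gain n^(2ε), which beats the denominator 2d + 5 = O(log n). -/
theorem exists_le_of_log_regime {ε K : ℝ} (hε : 0 < ε) (hK : 0 < K) :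
    ∃ c : ℝ, 0 < c ∧ ∀ (n d : ℕ) (ρ : ℝ), 1 ≤ n → 0 ≤ ρ → ρ < 1 →
      (d : ℝ) / 4 * Real.log (1 / (1 - ρ ^ 2)) ≤ (1 - ε) * Real.log n → d ≤ K * Real.log n →
      c ≤ n ^ 2 * badProb d (ρ / √(1 - ρ ^ 2)) := by
  refine ⟨Real.exp (-3) / 2 * (1 / (5 + K / ε)), by positivity, ?_⟩
  intro n d ρ hn hρ0 hρ1 h1 h2
  have hn0 : (0 : ℝ) < n := by exact_mod_cast hn
  set L := Real.log n with hL
  have hL0 : 0 ≤ L := Real.log_nonneg (by exact_mod_cast hn)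
  have hnL : (n : ℝ) ^ 2 = Real.exp (2 * L) := by
    rw [← Real.exp_log hn0, ← Real.exp_nat_mul]; norm_num [hL]
  have hd : (0 : ℝ) ≤ d := by positivity
  have h3 := badProb_ge_exp d hρ0 hρ1
  calc Real.exp (-3) / 2 * (1 / (5 + K / ε))
      ≤ Real.exp (-3) / 2 * (Real.exp (2 * ε * L) / (2 * d + 5)) := by
        gcongr ?_ * ?_
        rw [div_le_div_iff₀ (by positivity) (by positivity), one_mul]
        calc 2 * (d : ℝ) + 5 ≤ (2 * ε * L + 1) * (5 + K / ε) := by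
              have : (2 * ε * L + 1) * (5 + K / ε) = 10 * (ε * L) + 5 + K / ε + 2 * (K * L) := by
                field_simp; ring
              have h5 : 0 ≤ ε * L := by positivity
              have h6 : 0 ≤ K / ε := by positivity
              linarith
          _ ≤ _ := by
              gcongr
              exact Real.add_one_le_exp _
    _ ≤ Real.exp (-3) / 2 * (n ^ 2 * Real.exp (-2 * ((d : ℝ) / 4 *
          Real.log (1 / (1 - ρ ^ 2)))) / (2 * d + 5)) := by
        rw [hnL, ← Real.exp_add]
        gcongr
        linarith
    _ = n ^ 2 * (Real.exp (-3) / 2 * (Real.exp (-2 * ((d : ℝ) / 4 *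
          Real.log (1 / (1 - ρ ^ 2)))) / (2 * d + 5))) := by ring
    _ ≤ _ := by gcongr

/-- The term -log d gives a gain d², which beats 2d + 5 ≤ 7d² for d ≥ 1. -/
theorem exists_le_of_polynomial_regime (C : ℝ) :
    ∃ c : ℝ, 0 < c ∧ ∀ (n d : ℕ) (ρ : ℝ), 1 ≤ n → 1 ≤ d → 0 ≤ ρ → ρ < 1 →
      (d : ℝ) / 4 * Real.log (1 / (1 - ρ ^ 2)) ≤ Real.log n - Real.log d + C →
      c ≤ n ^ 2 * badProb d (ρ / √(1 - ρ ^ 2)) := by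
  refine ⟨Real.exp (-3) / 2 * (Real.exp (-2 * C) / 7), by positivity, ?_⟩
  intro n d ρ hn hd hρ0 hρ1 h1
  have hn0 : (0 : ℝ) < n := by exact_mod_cast hn
  have hd1 : (1 : ℝ) ≤ d := by exact_mod_cast hd
  have hexp : ∀ {k : ℕ}, (0 : ℝ) < k → (k : ℝ) ^ 2 = Real.exp (2 * Real.log k) := by
    intro k hk
    rw [two_mul, Real.exp_add, Real.exp_log hk, sq]
  have h3 := badProb_ge_exp d hρ0 hρ1
  calc Real.exp (-3) / 2 * (Real.exp (-2 * C) / 7)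
      ≤ Real.exp (-3) / 2 * (d ^ 2 * Real.exp (-2 * C) / (2 * d + 5)) := by
        gcongr ?_ * ?_
        rw [div_le_div_iff₀ (by norm_num) (by positivity)]
        have : 2 * (d : ℝ) + 5 ≤ 7 * d ^ 2 := by nlinarith
        nlinarith [Real.exp_pos (-2 * C)]
    _ ≤ Real.exp (-3) / 2 * (n ^ 2 * Real.exp (-2 * ((d : ℝ) / 4 *
          Real.log (1 / (1 - ρ ^ 2)))) / (2 * d + 5)) := by
        rw [hexp hn0, hexp (by linarith), ← Real.exp_add, ← Real.exp_add]
        gcongr _ * (Real.exp ?_ / _)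
        linarith
    _ = n ^ 2 * (Real.exp (-3) / 2 * (Real.exp (-2 * ((d : ℝ) / 4 *
          Real.log (1 / (1 - ρ ^ 2)))) / (2 * d + 5))) := by ring
    _ ≤ _ := by gcongr

end Impossibility

theorem theorem2
    (n d : ℕ → ℕ) (μ : ∀ k, EuclideanSpace ℝ (Fin (d k))) (ρ : ℕ → ℝ)
    (ν : ∀ k, PMF (CGMM.Labels (n k)))
    (hn : Tendsto n atTop atTop)
    (hρ : ∀ k, 0 ≤ ρ k ∧ ρ k ≤ 1)
    (hcond :
      (∃ ε : ℝ, 0 < ε ∧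
        (∀ᶠ k in atTop, ρ k < 1 ∧
          (d k : ℝ) / 4 * Real.log (1 / (1 - ρ k ^ 2)) ≤ (1 - ε) * Real.log (n k)) ∧
        Tendsto d atTop atTop ∧
        (fun k => (d k : ℝ)) =O[atTop] (fun k => Real.log (n k))) ∨
      (∃ C : ℝ, 0 < C ∧
        ∀ᶠ k in atTop, 0 < ρ k ∧ ρ k < 1 ∧
          (d k : ℝ) / 4 * Real.log (1 / (1 - ρ k ^ 2)) ≤
            Real.log (n k) - Real.log (d k) + C ∧
          1 / ρ k ^ 2 - 1 ≤ (d k : ℝ) / 40))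
    (est : ∀ k, CGMM.Database (n k) (d k) × CGMM.Database (n k) (d k) →
      Equiv.Perm (Fin (n k)))
    (hest : ∀ k, Measurable (est k)) :
    ¬ Tendsto (fun k => CGMM.exactMatchingProb (n k) (d k) (μ k) (ρ k) (ν k) (est k))
      atTop (𝓝 1) := by
  have hn8 : ∀ᶠ k in atTop, 8 ≤ n k := hn.eventually_ge_atTop 8
  obtain ⟨c, hc, hbad⟩ : ∃ c : ℝ, 0 < c ∧ ∀ᶠ k in atTop,
      ρ k < 1 ∧ c ≤ (n k : ℝ) ^ 2 * badProb (d k) (ρ k / √(1 - ρ k ^ 2)) := by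
    rcases hcond with ⟨ε, hε, hlog, -, hd⟩ | ⟨C, -, hlog⟩
    · obtain ⟨K, hK, hd⟩ := hd.exists_pos
      obtain ⟨c, hc, h⟩ := exists_le_of_log_regime hε hK
      refine ⟨c, hc, ?_⟩
      filter_upwards [hn8, hlog, hd.bound] with k h8 h1 h2
      have h3 : 0 ≤ Real.log (n k) := Real.log_natCast_nonneg _
      rw [Real.norm_of_nonneg (by positivity), Real.norm_of_nonneg h3] at h2
      exact ⟨h1.1, h _ _ _ (by omega) (hρ k).1 h1.1 h1.2 h2⟩
    · obtain ⟨c, hc, h⟩ := exists_le_of_polynomial_regime C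
      refine ⟨c, hc, ?_⟩
      filter_upwards [hn8, hlog] with k h8 ⟨h0, h1, h2, h3⟩
      -- For d = 0 the bound 1/ρ² - 1 ≤ d/40 would force ρ ≥ 1.
      have hd : 1 ≤ d k := by
        rw [Nat.one_le_iff_ne_zero]
        intro hd0
        rw [hd0, Nat.cast_zero, zero_div, sub_nonpos, div_le_one (by positivity)] at h3
        nlinarith
      exact ⟨h1, h _ _ _ (by omega) hd h0.le h1 h2⟩
  obtain ⟨δ, hδ, hle⟩ := exists_exactMatchingProb_le hc
  intro hlim
  have hgt := hlim.eventually (lt_mem_nhds (show 1 - δ < 1 by linarith))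
  obtain ⟨k, hk, h8, hρ1, hck⟩ := (hgt.and (hn8.and hbad)).exists
  exact absurd hk (not_lt.2 (hle _ _ _ _ _ _ (hest k) (hρ k).1 hρ1 h8 hck))
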